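/- **Setting.** Work in two-sorted logic with number variables $x,y,\dots$ (ranging over $\mathbb N$ in the standard model) and string variables $X,Y,\dots$ (ranging over finite subsets of $\mathbb N$), over the vocabulary $\mathcal L^2_A=[0,1,+,\cdot,|\ |;=_1,=_2,\le,\in]$. Here $X(t)$ means $t\in X$, and $|X|$ is $1$ plus the largest element of $X$ ($0$ if $X=\varnothing$). A $\Sigma^B_0$ formula has no string quantifiers and only bounded number quantifiers; a $\Sigma^B_1$ formula is a block of bounded quantifiers $\exists X\le t$ (meaning $\exists X(|X|\le t\wedge\dots)$) followed by a $\Sigma^B_0$ formula. A theory is the set of logical consequences of its axioms, and $\mathcal T\vdash\varphi$ means $\varphi\in\mathcal T$. A string function $F(\vec x,\vec X)$ is $\Sigma^B_1(\mathcal L_A^2)$-definable in $\mathcal T$ if there is a $\Sigma^B_1$ formula $\varphi(\vec x,\vec X,Y)$ over $\mathcal L^2_A$ such that $\mathcal T\vdash\forall\vec x\,\forall\vec X\,\exists!Y\,\varphi(\vec x,\vec X,Y)$ and, in the standard model, $Y=F(\vec x,\vec X)\leftrightarrow\varphi(\vec x,\vec X,Y)$. Let $\langle x,y\rangle=(x+y)(x+y+1)+2y$,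 let $X(x,y)$ mean $X(\langle x,y\rangle)$, let $Z^{[x]}=\{i: Z(\langle x,i\rangle)\}$, and let $Z^{[x][y]}=(Z^{[x]})^{[y]}$; further, $(Y)^z$ is the least $v$ with $Y(z,v)$, or $|Y|$ if there is none. A string $X$ codes the $n\times n$ matrix over $\mathbb Z_2$ whose $(i,j)$ entry is $1$ iff $X(i,j)$ (for $i,j<n$). It also codes the $n\times n$ integer matrix whose $(i,j)$ entry is the integer coded by $X^{[i][j]}$, where a string $S$ codes $(-1)^{S(0)}\sum_c S(c+1)2^c$. An output integer is coded with sign bit $1$ iff it is negative. All bits of an output string that do not belong to the coded object are $0$. * $\mathrm{Pow}_2(n,k,X)$ is the string coding $X^k$, the $k$-th power over $\mathbb Z_2$ of the $n\times n$ matrix coded by $X$. * $\mathrm{PowSeq}_2(n,k,X)$ is the string $Y$ coding the list $[I_n,X,X^2,\dots,X^k]$ of matrices over $\mathbb Z_2$, i.e. $Y^{[l]}=\mathrm{Pow}_2(n,l,X)$ for $l\le k$. * $\mathrm{PowSeq}_{\mathbb Z}(n,k,X)$ is the string $Y$ coding the list $[I_n,X,X^2,\dots,X^k]$ of powers of the $n\times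 n$ integer matrix coded by $X$, with $Y^{[l][i][j]}$ coding the $(i,j)$ entry of $X^l$ for $l\le k$ and $i,j<n$. **Theories.** $V^0$ is axiomatized by 2-BASIC and $\Sigma^B_0$-comprehension. $V^0(2)$ is $V^0$ plus the parity axiom $\exists Y\le x+1\,(\neg Y(0)\wedge\forall z<x\,(Y(z+1)\leftrightarrow X(z)\oplus Y(z)))$. $VTC^0$ is $V^0$ plus the axiom NUMONES, which says that there is $Y\le 1+\langle x,x\rangle$ with $(Y)^0=0$ and, for all $z<x$, $(Y)^{z+1}=(Y)^z+1$ if $X(z)$ and $(Y)^{z+1}=(Y)^z$ otherwise. $V{\oplus}L$ is $V^0(2)$ plus the $\Sigma^B_1(\mathcal L^2_A)$ axiom $$PS_2:\quad \exists Y\le\langle k,\langle n,n\rangle\rangle\ \exists Z\le t\ \alpha(n,k,X,Y,Z).$$ Here $\alpha$ is a $\Sigma^B_0$ formula saying that $Y$ codes $[I_n,X,\dots,X^k]$ over $\mathbb Z_2$: every bit of $Y$ is of the form $\langle l,\langle i,j\rangle\rangle$ with $l\le k$ and $i,j<n$; $Y^{[0]}$ is the identity; and for $l<k$ and $i,j<n$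 the bit $Y^{[l+1]}(i,j)$ is the parity of $\{b<n: X(i,b)\wedge Y^{[l]}(b,j)\}$, as witnessed by the prefix parities stored in $Z$; $t=\langle k,\langle n,\langle n,n\rangle\rangle\rangle$. $V\#L$ is $VTC^0$ plus the analogous $\Sigma^B_1(\mathcal L_A^2)$ axiom $$PS_{\mathbb Z}:\quad \exists Y\le\langle k,\langle n,\langle n,D+1\rangle\rangle\rangle\ \exists Z\le t'\ \alpha_{\mathbb Z}(n,k,X,Y,Z),\qquad D=k(n+|X|)+1,$$ for integer matrices. Here $\alpha_{\mathbb Z}$ is a $\Sigma^B_0$ formula saying that every bit of $Y$ is of the form $\langle l,\langle i,\langle j,d\rangle\rangle\rangle$ with $l\le k$, $i,j<n$, $d\le D$; that $Y^{[0]}$ is the identity; and that for $l<k$ and $i,j<n$ the integer $Y^{[l+1][i][j]}$ is the difference (sign and absolute value, by bitwise subtraction with borrows) of the sum of the absolute values of the nonnegative terms $X^{[i][b]}\cdot Y^{[l][b][j]}$ ($b<n$) and that of the negative ones. The string $Z$ stores, in binary, the partial results of the shift-and-add multiplications and the partial sums, each obtained from the previous one by bitwise addition with carries; $t'=\langle 2,\langle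 k,\langle n,\langle n,\langle n,\langle |X|,D\rangle\rangle\rangle\rangle\rangle\rangle$. **Lemma.** 1. $\mathrm{PowSeq}_2$ is $\Sigma^B_1(\mathcal L^2_A)$-definable in $V{\oplus}L$. 2. $\mathrm{Pow}_2$ is $\Sigma^B_1(\mathcal L^2_A)$-definable in $V{\oplus}L$. 3. $\mathrm{PowSeq}_{\mathbb Z}$ is $\Sigma^B_1(\mathcal L^2_A)$-definable in $V\#L$. -/

import Mathlib

/-!
Two-sorted bounded arithmetic over the vocabulary `L²_A = [0, 1, +, ·, | | ; =₁, =₂, ≤, ∈]`: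
syntax, structures, the classes `Σ^B_0` and `Σ^B_1`, the theories `V⁰`, `V⁰(2)`, `VTC⁰`, `V⊕L`, `V#L`,
definability of string functions in a theory, and the matrix powering functions.
-/

namespace TwoSorted

/-! ### Syntax -/

/-- Number terms of `L²_A`. Number variables and string variables are both indexed by `ℕ`
(two separate supplies); the only string terms of `L²_A` are the string variables. -/
inductive Term : Type
  | var (x : ℕ) : Term
  | zero : Term
  | one : Term
  | add (s t : Term) : Term
  | mul (s t : Term) : Term
  | len (X : ℕ) : Term

namespace Term

instance : Zero Term := ⟨zero⟩
instance : One Term := ⟨one⟩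
instance : Add Term := ⟨add⟩
instance : Mul Term := ⟨mul⟩

/-- The number variables of a term. -/
def numVars : Term → Finset ℕ
  | var x => {x}
  | zero => ∅
  | one => ∅
  | add s t => s.numVars ∪ t.numVars
  | mul s t => s.numVars ∪ t.numVars
  | len _ => ∅

/-- The string variables of a term. -/
def strVars : Term → Finset ℕ
  | var _ => ∅
  | zero => ∅
  | one => ∅
  | add s t => s.strVars ∪ t.strVars
  | mul s t => s.strVars ∪ t.strVars
  | len X => {X}

/-- The pairing term `⟨s, t⟩ = (s + t)(s + t + 1) + 2t`. -/
def pair (s t : Term) : Term := (s + t) * (s + t + 1) + (1 + 1) * t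

end Term

/-- Formulas of two-sorted first-order logic over `L²_A`; `mem t X` is the atom `X(t)`. -/
inductive Formula : Type
  | eqN (s t : Term) : Formula
  | eqS (X Y : ℕ) : Formula
  | le (s t : Term) : Formula
  | mem (t : Term) (X : ℕ) : Formula
  | neg (φ : Formula) : Formula
  | and (φ ψ : Formula) : Formula
  | or (φ ψ : Formula) : Formula
  | allN (x : ℕ) (φ : Formula) : Formula
  | exN (x : ℕ) (φ : Formula) : Formula
  | allS (X : ℕ) (φ : Formula) : Formula
  | exS (X : ℕ) (φ : Formula) : Formula

namespace Formula

/-- The free number variables. -/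
def freeNum : Formula → Finset ℕ
  | eqN s t => s.numVars ∪ t.numVars
  | eqS _ _ => ∅
  | le s t => s.numVars ∪ t.numVars
  | mem t _ => t.numVars
  | neg φ => φ.freeNum
  | and φ ψ => φ.freeNum ∪ ψ.freeNum
  | or φ ψ => φ.freeNum ∪ ψ.freeNum
  | allN x φ => φ.freeNum.erase x
  | exN x φ => φ.freeNum.erase x
  | allS _ φ => φ.freeNum
  | exS _ φ => φ.freeNum

/-- The free string variables. -/
def freeStr : Formula → Finset ℕ
  | eqN s t => s.strVars ∪ t.strVars
  | eqS X Y => {X, Y}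
  | le s t => s.strVars ∪ t.strVars
  | mem t X => insert X t.strVars
  | neg φ => φ.freeStr
  | and φ ψ => φ.freeStr ∪ ψ.freeStr
  | or φ ψ => φ.freeStr ∪ ψ.freeStr
  | allN _ φ => φ.freeStr
  | exN _ φ => φ.freeStr
  | allS X φ => φ.freeStr.erase X
  | exS X φ => φ.freeStr.erase X

/-- Implication `φ ⊃ ψ`. -/
def imp (φ ψ : Formula) : Formula := or (neg φ) ψ

/-- Equivalence `φ ↔ ψ`. -/
def iff (φ ψ : Formula) : Formula := and (imp φ ψ) (imp ψ φ)

/-- Exclusive or `φ ⊕ ψ`. -/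
def xor (φ ψ : Formula) : Formula := or (and φ (neg ψ)) (and (neg φ) ψ)

/-- `s < t` stands for `s ≤ t ∧ s ≠ t`. -/
def lt (s t : Term) : Formula := and (le s t) (neg (eqN s t))

/-- `∀ x ≤ t, φ`. -/
def allLe (x : ℕ) (t : Term) (φ : Formula) : Formula := allN x (imp (le (.var x) t) φ)

/-- `∃ x ≤ t, φ`. -/
def exLe (x : ℕ) (t : Term) (φ : Formula) : Formula := exN x (and (le (.var x) t) φ)

/-- `∀ x < t, φ`. -/
def allLt (x : ℕ) (t : Term) (φ : Formula) : Formula := allLe x t (imp (lt (.var x) t) φ)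

/-- `∃ x < t, φ`. -/
def exLt (x : ℕ) (t : Term) (φ : Formula) : Formula := exLe x t (and (lt (.var x) t) φ)

/-- `∃ X ≤ t, φ`, that is, `∃ X (|X| ≤ t ∧ φ)`. -/
def exSLe (X : ℕ) (t : Term) (φ : Formula) : Formula := exS X (and (le (.len X) t) φ)

/-- `∃! X, φ`, written as `∃ Y ∀ X (φ ↔ X = Y)`; the variable `Y` must not be free in `φ`. -/
def exSUnique (X Y : ℕ) (φ : Formula) : Formula := exS Y (allS X (iff φ (eqS X Y)))

/-- `Σ^B_0` formulas: no string quantifiers, and all number quantifiers are bounded. -/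
inductive IsSigmaB0 : Formula → Prop
  | eqN (s t : Term) : IsSigmaB0 (eqN s t)
  | eqS (X Y : ℕ) : IsSigmaB0 (eqS X Y)
  | le (s t : Term) : IsSigmaB0 (le s t)
  | mem (t : Term) (X : ℕ) : IsSigmaB0 (mem t X)
  | neg {φ : Formula} : IsSigmaB0 φ → IsSigmaB0 (neg φ)
  | and {φ ψ : Formula} : IsSigmaB0 φ → IsSigmaB0 ψ → IsSigmaB0 (and φ ψ)
  | or {φ ψ : Formula} : IsSigmaB0 φ → IsSigmaB0 ψ → IsSigmaB0 (or φ ψ)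
  | allLe {x : ℕ} {t : Term} {φ : Formula} :
      x ∉ t.numVars → IsSigmaB0 φ → IsSigmaB0 (allLe x t φ)
  | exLe {x : ℕ} {t : Term} {φ : Formula} :
      x ∉ t.numVars → IsSigmaB0 φ → IsSigmaB0 (exLe x t φ)

/-- `Σ^B_1` formulas: a (possibly empty) block of bounded existential string quantifiers followed by
a `Σ^B_0` formula. -/
inductive IsSigmaB1 : Formula → Prop
  | sigmaB0 {φ : Formula} : IsSigmaB0 φ → IsSigmaB1 φ
  | exSLe {X : ℕ} {t : Term} {φ : Formula} :
      X ∉ t.strVars → IsSigmaB1 φ → IsSigmaB1 (exSLe X t φ)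

end Formula

/-! ### Semantics and theories -/

/-- Two-sorted structures for `L²_A`, with both equality symbols interpreted as true equality. -/
structure Struct where
  /-- the domain of the number sort -/
  Num : Type
  /-- the domain of the string sort -/
  Str : Type
  str_nonempty : Nonempty Str
  zero : Num
  one : Num
  add : Num → Num → Num
  mul : Num → Num → Num
  le : Num → Num → Prop
  len : Str → Num
  mem : Num → Str → Prop

/-- The value of a number term under an assignment of the variables. -/
def Term.eval (M : Struct) (e : ℕ → M.Num) (E : ℕ → M.Str) : Term → M.Num
  | var x => e x
  | zero => M.zero
  | one => M.one
  | add s t => M.add (s.eval M e E) (t.eval M e E)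
  | mul s t => M.mul (s.eval M e E) (t.eval M e E)
  | len X => M.len (E X)

/-- Truth of a formula in a structure under an assignment of the variables. -/
def Formula.Realize (M : Struct) : Formula → (ℕ → M.Num) → (ℕ → M.Str) → Prop
  | eqN s t, e, E => s.eval M e E = t.eval M e E
  | eqS X Y, _, E => E X = E Y
  | le s t, e, E => M.le (s.eval M e E) (t.eval M e E)
  | mem t X, e, E => M.mem (t.eval M e E) (E X)
  | neg φ, e, E => ¬ φ.Realize M e E
  | and φ ψ, e, E => φ.Realize M e E ∧ ψ.Realize M e E
  | or φ ψ, e, E => φ.Realize M e E ∨ ψ.Realize M e E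
  | allN x φ, e, E => ∀ a : M.Num, φ.Realize M (Function.update e x a) E
  | exN x φ, e, E => ∃ a : M.Num, φ.Realize M (Function.update e x a) E
  | allS X φ, e, E => ∀ A : M.Str, φ.Realize M e (Function.update E X A)
  | exS X φ, e, E => ∃ A : M.Str, φ.Realize M e (Function.update E X A)

/-- `M ⊨ φ`: the universal closure of `φ` is true in `M`. -/
def Struct.Satisfies (M : Struct) (φ : Formula) : Prop :=
  ∀ (e : ℕ → M.Num) (E : ℕ → M.Str), φ.Realize M e E

/-- `T ⊢ φ` for the theory axiomatized by `T`: a theory is the set of logical consequences of its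
axioms (which are understood to be universally closed). As the vocabulary is countable, it does not
matter that only structures with domains in `Type` are considered. -/
def Proves (T : Set Formula) (φ : Formula) : Prop :=
  ∀ M : Struct, (∀ ψ ∈ T, M.Satisfies ψ) → M.Satisfies φ

/-- The length `|X|` of a finite set `X ⊆ ℕ`: one more than its largest element, and `0` for `∅`. -/
def strLen (X : Finset ℕ) : ℕ := X.sup (fun i => i + 1)

/-- The standard model: natural numbers and finite sets of natural numbers. -/
def standardModel : Struct where
  Num := ℕ
  Str := Finset ℕ
  str_nonempty := ⟨∅⟩
  zero := 0
  one := 1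
  add := fun a b => a + b
  mul := fun a b => a * b
  le := fun a b => a ≤ b
  len := strLen
  mem := fun a X => a ∈ X

/-- The string function `F` of `p` number and `q` string arguments is `Φ`-definable in the theory
`T`: some `φ(x₀, …, x_{p-1}, X₀, …, X_{q-1}, Y)` in `Φ` with no further free variables (`Y` is the
string variable with index `q`) satisfies `T ⊢ ∀ x⃗ ∀ X⃗ ∃! Y φ(x⃗, X⃗, Y)`, and it represents the graph
of `F` in the standard model. -/
def StringDefinable (Φ : Set Formula) (T : Set Formula) (p q : ℕ)
    (F : (Fin p → ℕ) → (Fin q → Finset ℕ) → Finset ℕ) : Prop :=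
  ∃ φ ∈ Φ, φ.freeNum ⊆ Finset.range p ∧ φ.freeStr ⊆ Finset.range (q + 1) ∧
    Proves T (Formula.exSUnique q (q + 1) φ) ∧
    ∀ (e : ℕ → ℕ) (E : ℕ → Finset ℕ),
      E q = F (fun i => e i) (fun i => E i) ↔ φ.Realize standardModel e E

/-- The set of all `Σ^B_1(L²_A)` formulas. -/
def SigmaB1 : Set Formula := {φ | φ.IsSigmaB1}

section Axioms

open Term Formula

/-- The axioms 2-BASIC: B1 to B12, L1, L2 and SE (extensionality). -/
def twoBasic : Set Formula :=
  let x := var 0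
  let y := var 1
  { neg (eqN (x + 1) 0),
    imp (eqN (x + 1) (y + 1)) (eqN x y),
    eqN (x + 0) x,
    eqN (x + (y + 1)) (x + y + 1),
    eqN (x * 0) 0,
    eqN (x * (y + 1)) (x * y + x),
    imp (and (le x y) (le y x)) (eqN x y),
    le x (x + y),
    le 0 x,
    or (le x y) (le y x),
    iff (le x y) (lt x (y + 1)),
    imp (neg (eqN x 0)) (exLe 1 x (eqN (y + 1) x)),
    imp (mem y 0) (lt y (len 0)),
    imp (eqN (y + 1) (len 0)) (mem y 0),
    imp (and (eqN (len 0) (len 1)) (allLt 0 (len 0) (iff (mem x 0) (mem x 1)))) (eqS 0 1) }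

/-- The comprehension scheme `Σ^B_0`-COMP: `∃ X ≤ y ∀ z < y (X(z) ↔ φ(z))` for `φ` in `Σ^B_0`
without free `X` (other free variables of `φ` are parameters). -/
def sigmaB0Comp : Set Formula :=
  {ψ | ∃ (φ : Formula) (y z X : ℕ), φ.IsSigmaB0 ∧ y ≠ z ∧ X ∉ φ.freeStr ∧
    ψ = exSLe X (var y) (allLt z (var y) (iff (mem (var z) X) φ))}

/-- The theory `V⁰`. -/
def V0 : Set Formula := twoBasic ∪ sigmaB0Comp

/-- The parity axiom `∃ Y ≤ x + 1 (¬Y(0) ∧ ∀ z < x (Y(z + 1) ↔ (X(z) ⊕ Y(z))))`. -/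
def parityAxiom : Formula :=
  let x := var 0
  let z := var 1
  exSLe 1 (x + 1) (and (neg (mem 0 1))
    (allLt 1 x (iff (mem (z + 1) 1) (xor (mem z 0) (mem z 1)))))

/-- The theory `V⁰(2)`. -/
def V0Mod2 : Set Formula := V0 ∪ {parityAxiom}

/-- `v = seq(z, Y)`, that is, `(Y)^z = v`; the bound variable is number variable `w`. -/
def seqEq (z : Term) (Y : ℕ) (v : Term) (w : ℕ) : Formula :=
  or (and (lt v (len Y)) (and (mem (pair z v) Y) (allLt w v (neg (mem (pair z (var w)) Y)))))
    (and (allLt w (len Y) (neg (mem (pair z (var w)) Y))) (eqN v (len Y)))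

/-- The axiom NUMONES: there is a `Y ≤ 1 + ⟨x, x⟩` with `(Y)^0 = 0` and, for all `z < x`,
`(Y)^{z+1} = (Y)^z + 1` if `X(z)` and `(Y)^{z+1} = (Y)^z` if `¬X(z)`. -/
def numonesAxiom : Formula :=
  let x := var 0
  let z := var 1
  let v := var 2
  exSLe 1 (1 + pair x x) (and (seqEq 0 1 0 3)
    (allLt 1 x (exLe 2 (len 1) (and (seqEq z 1 v 3)
      (and (imp (mem z 0) (seqEq (z + 1) 1 (v + 1) 3))
        (imp (neg (mem z 0)) (seqEq (z + 1) 1 v 3)))))))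

/-- The theory `VTC⁰`. -/
def VTC0 : Set Formula := V0 ∪ {numonesAxiom}

/-! ### The axiom `PS₂` and the theory `V⊕L` -/

/-- The `Σ^B_0` formula `α(n, k, X, Y, Z)` for matrix powering over `ℤ₂`. It says that the list `Y`
has no bits besides the bits `⟨l, ⟨i, j⟩⟩` with `l ≤ k` and `i, j < n`, that `Y^{[0]} = ID(n)`, and
that `Y^{[l+1]} = Prod₂(n, X, Y^{[l]})` for `l < k`, where `Z` holds for all `i, j < n` the
parities `Z(l, i, j, b)` of the number of `b' < b` with `X(i, b') ∧ Y^{[l]}(b', j)`.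
The number variables `n`, `k` have index `0`, `1`; the strings `X`, `Y`, `Z` have index `0`, `1`, `2`. -/
def alpha2 : Formula :=
  let n := var 0
  let k := var 1
  let l := var 2
  let i := var 3
  let j := var 4
  let b := var 5
  let Y (l i j : Term) : Formula := mem (pair l (pair i j)) 1
  let Z (b : Term) : Formula := mem (pair l (pair i (pair j b))) 2
  and (allLt 5 (len 1) (imp (mem b 1)
      (exLe 2 k (exLt 3 n (exLt 4 n (eqN b (pair l (pair i j))))))))
  (and (allLt 3 n (allLt 4 n (iff (Y 0 i j) (eqN i j))))
    (allLt 2 k (allLt 3 n (allLt 4 n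
      (and (neg (Z 0))
      (and (allLt 5 n (iff (Z (b + 1)) (xor (and (mem (pair i b) 0) (Y l b j)) (Z b))))
        (iff (Y (l + 1) i j) (Z n))))))))

/-- The `Σ^B_1` axiom `PS₂`: `∃ Y ≤ ⟨k, ⟨n, n⟩⟩ ∃ Z ≤ ⟨k, ⟨n, ⟨n, n⟩⟩⟩ α(n, k, X, Y, Z)`. -/
def PS2 : Formula :=
  let n := var 0
  let k := var 1
  exSLe 1 (pair k (pair n n)) (exSLe 2 (pair k (pair n (pair n n))) alpha2)

/-- The theory `V⊕L`. -/
def VParityL : Set Formula := V0Mod2 ∪ {PS2}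

/-! ### The axiom `PS_ℤ` and the theory `V#L`

A bit predicate `A : Term → Formula` stands for the number `∑ 2^d` over the `d` with `A d`. The
number variables with index `8` and `9` are reserved for the quantifiers of `carry`, `less` and
`borrow`, and must not occur in the other arguments (`A` applied to them excepted). -/

/-- There is a carry into bit `d` in the sum of `A` and `B`. -/
def carry (A B : Term → Formula) (d : Term) : Formula :=
  exLt 8 d (and (A (var 8)) (and (B (var 8))
    (allLt 9 d (imp (lt (var 8) (var 9)) (or (A (var 9)) (B (var 9)))))))

/-- Bit `d` of the sum of `A` and `B`. -/
def sumBit (A B : Term → Formula) (d : Term) : Formula :=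
  xor (xor (A d) (B d)) (carry A B d)

/-- The number `A` is smaller than the number `B`, where only bits below `D` count. -/
def less (A B : Term → Formula) (D : Term) : Formula :=
  exLt 8 D (and (B (var 8)) (and (neg (A (var 8)))
    (allLt 9 D (imp (lt (var 8) (var 9)) (imp (A (var 9)) (B (var 9)))))))

/-- `B < A`, and bit `d` of `A` is borrowed from in the subtraction `A - B`. -/
def borrow (A B : Term → Formula) (D d : Term) : Formula :=
  and (less B A D)
    (exLt 8 d (and (neg (A (var 8))) (and (B (var 8))
      (allLt 9 d (imp (lt (var 8) (var 9)) (or (neg (A (var 9))) (B (var 9))))))))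

/-- Bit `d` of the absolute value of `A - B`. -/
def diffBit (A B : Term → Formula) (D d : Term) : Formula :=
  xor (xor (A d) (B d)) (or (borrow A B D d) (borrow B A D d))

/-- The term `D = k(n + |X|) + 1`: the absolute values of the entries of all `X^l` with `l ≤ k` and
of all sums formed in computing them are below `2^D`. -/
def widthZ : Term := var 1 * (var 0 + len 0) + 1

/-- The `Σ^B_0` formula `α(n, k, X, Y, Z)` for matrix powering over `ℤ`. Entry `(i, j)` of the matrix
coded by `X` is the integer `X^{[i][j]}`, whose bit `0` is the sign and whose bit `d + 1` has weight
`2^d`; the list `Y` has the entries `Y^{[l][i][j]}`. The formula says that `Y` has no bits besides the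
bits `⟨l, ⟨i, ⟨j, d⟩⟩⟩` with `l ≤ k`, `i, j < n` and `d ≤ D`, that `Y^{[0]} = ID_ℤ(n)`, and that
`Y^{[l+1]} = Prod_ℤ(n, X, Y^{[l]})` for `l < k`. The string `Z` holds in binary, for all `i, j < n`,
* `Q(b, c)` for `b < n` and `c ≤ |X|`: the product of the number given by the lowest `c` bits of the
  absolute value of `X^{[i][b]}` with the absolute value of `Y^{[l][b][j]}`,
* `P(b)` and `N(b)` for `b ≤ n`: the sums of the absolute values of the nonnegative and of the
  negative ones of the products of `X^{[i][b']}` and `Y^{[l][b'][j]}` with `b' < b`.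
The number variables `n`, `k` have index `0`, `1`; the strings `X`, `Y`, `Z` have index `0`, `1`, `2`. -/
def alphaZ : Formula :=
  let n := var 0
  let k := var 1
  let l := var 2
  let i := var 3
  let j := var 4
  let b := var 5
  let c := var 6
  let d := var 7
  let g := var 10
  let D := widthZ
  let X (i j d : Term) : Formula := mem (pair i (pair j d)) 0
  let Y (l i j d : Term) : Formula := mem (pair l (pair i (pair j d))) 1
  let Q (b c d : Term) : Formula := mem (pair 0 (pair l (pair i (pair j (pair b (pair c d)))))) 2
  let P (b d : Term) : Formula := mem (pair 1 (pair l (pair i (pair j (pair b d))))) 2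
  let N (b d : Term) : Formula := mem (pair (1 + 1) (pair l (pair i (pair j (pair b d))))) 2
  let shifted (d : Term) : Formula :=
    and (X i b (c + 1)) (exLe 10 d (and (eqN (c + g) d) (Y l b j (g + 1))))
  let sameSign : Formula := iff (X i b 0) (Y l b j 0)
  and (allLt 5 (len 1) (imp (mem b 1)
      (exLe 2 k (exLt 3 n (exLt 4 n (exLe 7 D (eqN b (pair l (pair i (pair j d))))))))))
  (and (allLt 3 n (allLt 4 n (allLe 7 D (iff (Y 0 i j d) (and (eqN i j) (eqN d 1))))))
    (allLt 2 k (allLt 3 n (allLt 4 n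
      (and (allLt 5 n (allLt 7 D (neg (Q b 0 d))))
      (and (allLt 5 n (allLt 6 (len 0) (allLt 7 D
        (iff (Q b (c + 1) d) (sumBit (Q b c) shifted d)))))
      (and (allLt 7 D (and (neg (P 0 d)) (neg (N 0 d))))
      (and (allLt 5 n (allLt 7 D
        (and (iff (P (b + 1) d) (sumBit (P b) (fun d => and sameSign (Q b (len 0) d)) d))
          (iff (N (b + 1) d) (sumBit (N b) (fun d => and (neg sameSign) (Q b (len 0) d)) d)))))
      (and (iff (Y (l + 1) i j 0) (less (P n) (N n) D))
        (allLt 7 D (iff (Y (l + 1) i j (d + 1)) (diffBit (P n) (N n) D d))))))))))))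

/-- The `Σ^B_1` axiom `PS_ℤ`: `∃ Y ≤ ⟨k, ⟨n, ⟨n, D + 1⟩⟩⟩ ∃ Z ≤ t, α(n, k, X, Y, Z)` with
`t = ⟨2, ⟨k, ⟨n, ⟨n, ⟨n, ⟨|X|, D⟩⟩⟩⟩⟩⟩`. -/
def PSZ : Formula :=
  let n := var 0
  let k := var 1
  exSLe 1 (pair k (pair n (pair n (widthZ + 1))))
    (exSLe 2 (pair (1 + 1) (pair k (pair n (pair n (pair n (pair (len 0) widthZ)))))) alphaZ)

/-- The theory `V#L`. -/
def VSharpL : Set Formula := VTC0 ∪ {PSZ}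

end Axioms

/-! ### The matrix powering functions -/

/-- The pairing function `⟨x, y⟩ = (x + y)(x + y + 1) + 2y`. -/
def pairNat (x y : ℕ) : ℕ := (x + y) * (x + y + 1) + 2 * y

/-- `Row(x, Z) = Z^{[x]}`. -/
def row (x : ℕ) (Z : Finset ℕ) : Finset ℕ :=
  (Finset.range (strLen Z)).filter (fun i => pairNat x i ∈ Z)

/-- The `n × n` matrix over `ℤ₂` coded by `X`: entry `(i, j)` is `1` iff `X(i, j)`. -/
def matrix2 (n : ℕ) (X : Finset ℕ) : Matrix (Fin n) (Fin n) (ZMod 2) :=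
  fun i j => if pairNat i j ∈ X then 1 else 0

/-- `Pow₂(n, k, X)`: the string coding the `k`-th power of the matrix coded by `X`. -/
def pow2 (n k : ℕ) (X : Finset ℕ) : Finset ℕ :=
  ((Finset.univ : Finset (Fin n × Fin n)).filter
    (fun a => (matrix2 n X ^ k) a.1 a.2 = 1)).image (fun a => pairNat a.1 a.2)

/-- `PowSeq₂(n, k, X)`: the string coding the list `[ID(n), X, X², …, X^k]` of matrices over `ℤ₂`;
its row `l ≤ k` is `Pow₂(n, l, X)`, and it has no other bits. -/
def powSeq2 (n k : ℕ) (X : Finset ℕ) : Finset ℕ :=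
  (Finset.range (k + 1)).biUnion (fun l => (pow2 n l X).image (fun a => pairNat l a))

/-- The integer coded by a string: bit `0` is the sign, bit `c + 1` has weight `2^c`. -/
def intValue (S : Finset ℕ) : ℤ :=
  (if 0 ∈ S then -1 else 1) * ∑ c ∈ Finset.range (strLen S), if c + 1 ∈ S then 2 ^ c else 0

/-- The string coding an integer: bit `0` is set iff it is negative, and bit `c + 1` is bit `c` of
its absolute value. -/
def intString (x : ℤ) : Finset ℕ :=
  (if x < 0 then {0} else ∅) ∪
    ((Finset.range x.natAbs).filter (fun c => x.natAbs.testBit c)).image (fun c => c + 1)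

/-- The `n × n` integer matrix coded by `X`: entry `(i, j)` is coded by `X^{[i][j]}`. -/
def matrixZ (n : ℕ) (X : Finset ℕ) : Matrix (Fin n) (Fin n) ℤ :=
  fun i j => intValue (row j (row i X))

/-- `Pow_ℤ(n, k, X)`: the string coding the `k`-th power of the integer matrix coded by `X`. -/
def powZ (n k : ℕ) (X : Finset ℕ) : Finset ℕ :=
  (Finset.univ : Finset (Fin n × Fin n)).biUnion
    (fun a => (intString ((matrixZ n X ^ k) a.1 a.2)).image
      (fun c => pairNat a.1 (pairNat a.2 c)))

/-- `PowSeq_ℤ(n, k, X)`: the string coding the list `[ID_ℤ(n), X, X², …, X^k]` of integer matrices;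
its row `l ≤ k` is `Pow_ℤ(n, l, X)`, and it has no other bits. -/
def powSeqZ (n k : ℕ) (X : Finset ℕ) : Finset ℕ :=
  (Finset.range (k + 1)).biUnion (fun l => (powZ n l X).image (fun a => pairNat l a))

end TwoSorted

/-!
The formula that defines each function is the one that occurs in the axiom: `∃ Z ≤ t, α(n, k, X, Y, Z)`
for the two lists of powers, and, for a single power over `ℤ₂`, "there is a list `W` of powers whose
row `k` is `Y`". Three facts have to be checked (`stringDefinable_of_unique`).

* Existence of the output in every model of the theory is the axiom `PS₂` or `PS_ℤ` itself; a row of a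
  list is obtained by `Σ^B_0`-comprehension.
* Uniqueness of the output holds in every model of `V⁰` (`eq_of_alpha2`, `eq_of_alphaZ`). If `Y, Z` and
  `Y', Z'` both satisfy `α`, then `Y^{[l]}` and `Y'^{[l]}` agree on all relevant bits by `Σ^B_0`-induction
  on `l`; in the step, the parts of `Z` and `Z'` that record the computation of matrix `l + 1` agree by an
  inner induction. Since `α` also says that `Y` has no other bits, extensionality gives `Y = Y'`. No
  property of the pairing function is needed. `Σ^B_0`-induction (`Struct.Models.induction`) comes from
  comprehension, because a nonempty string has a largest element.
* The graph is the right one in the standard model. As that is a model of `V⁰`, uniqueness reduces this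
  to the claim that the value of the function satisfies the formula, for which a suitable `Z` is
  exhibited (`parityTable`, `computationTable`). Over `ℤ`, the bits of `Z` are those of explicit partial
  products and sums, so the claim amounts to the correctness of bitwise addition, comparison and
  subtraction. All three rest on one recursion (`dominant_succ`), by which a carry into bit `d` of
  `a + b` means `2^d ≤ a % 2^d + b % 2^d`, and `a` is smaller than `b` on the bits below `d` iff
  `a % 2^d < b % 2^d`. The width `D` suffices by the bound `2^{l(n + |X|)}` on the entries of the `l`-th
  power (`natAbs_powEntry_le`).
-/

namespace TwoSorted

/-! ### Syntax and evaluation -/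

namespace Struct

/-- The strict order `s < t`, which abbreviates `s ≤ t ∧ s ≠ t`. -/
def lt (M : Struct) (a b : M.Num) : Prop := M.le a b ∧ a ≠ b

/-- The value of the pairing term. -/
def pair (M : Struct) (a b : M.Num) : M.Num :=
  M.add (M.mul (M.add a b) (M.add (M.add a b) M.one)) (M.mul (M.add M.one M.one) b)

end Struct

namespace Term

variable (M : Struct) (e : ℕ → M.Num) (E : ℕ → M.Str)

@[simp] theorem eval_var (x : ℕ) : (var x).eval M e E = e x := rfl
@[simp] theorem eval_zero : (0 : Term).eval M e E = M.zero := rfl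
@[simp] theorem eval_one : (1 : Term).eval M e E = M.one := rfl
@[simp] theorem eval_add (s t : Term) :
    (s + t).eval M e E = M.add (s.eval M e E) (t.eval M e E) := rfl
@[simp] theorem eval_mul (s t : Term) :
    (s * t).eval M e E = M.mul (s.eval M e E) (t.eval M e E) := rfl
@[simp] theorem eval_len (X : ℕ) : (len X).eval M e E = M.len (E X) := rfl
@[simp] theorem eval_pair (s t : Term) :
    (pair s t).eval M e E = M.pair (s.eval M e E) (t.eval M e E) := rfl

theorem eval_congr {M : Struct} {e e' : ℕ → M.Num} {E E' : ℕ → M.Str} (t : Term)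
    (he : ∀ x ∈ t.numVars, e x = e' x) (hE : ∀ X ∈ t.strVars, E X = E' X) :
    t.eval M e E = t.eval M e' E' := by
  induction t with
  | var x => exact he x (by simp [numVars])
  | zero => rfl
  | one => rfl
  | add s t hs ht =>
    simp only [eval]
    rw [hs (fun x h => he x (by simp [numVars, h])) (fun x h => hE x (by simp [strVars, h])),
      ht (fun x h => he x (by simp [numVars, h])) (fun x h => hE x (by simp [strVars, h]))]
  | mul s t hs ht =>
    simp only [eval]
    rw [hs (fun x h => he x (by simp [numVars, h])) (fun x h => hE x (by simp [strVars, h])),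
      ht (fun x h => he x (by simp [numVars, h])) (fun x h => hE x (by simp [strVars, h]))]
  | len X => simp only [eval]; rw [hE X (by simp [strVars])]

end Term

namespace Formula

section Realize

variable (M : Struct) (e : ℕ → M.Num) (E : ℕ → M.Str)

@[simp] theorem realize_eqN (s t : Term) :
    (eqN s t).Realize M e E ↔ s.eval M e E = t.eval M e E := Iff.rfl
@[simp] theorem realize_eqS (X Y : ℕ) : (eqS X Y).Realize M e E ↔ E X = E Y := Iff.rfl
@[simp] theorem realize_le (s t : Term) :
    (le s t).Realize M e E ↔ M.le (s.eval M e E) (t.eval M e E) := Iff.rfl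
@[simp] theorem realize_mem (t : Term) (X : ℕ) :
    (mem t X).Realize M e E ↔ M.mem (t.eval M e E) (E X) := Iff.rfl
@[simp] theorem realize_neg (φ : Formula) : (neg φ).Realize M e E ↔ ¬ φ.Realize M e E := Iff.rfl
@[simp] theorem realize_and (φ ψ : Formula) :
    (and φ ψ).Realize M e E ↔ φ.Realize M e E ∧ ψ.Realize M e E := Iff.rfl
@[simp] theorem realize_or (φ ψ : Formula) :
    (or φ ψ).Realize M e E ↔ φ.Realize M e E ∨ ψ.Realize M e E := Iff.rfl
@[simp] theorem realize_imp (φ ψ : Formula) :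
    (imp φ ψ).Realize M e E ↔ (φ.Realize M e E → ψ.Realize M e E) :=
  imp_iff_not_or.symm
@[simp] theorem realize_iff (φ ψ : Formula) :
    (iff φ ψ).Realize M e E ↔ (φ.Realize M e E ↔ ψ.Realize M e E) := by
  simp only [iff, realize_and, realize_imp]; exact iff_iff_implies_and_implies.symm
@[simp] theorem realize_xor (φ ψ : Formula) :
    (xor φ ψ).Realize M e E ↔ Xor (φ.Realize M e E) (ψ.Realize M e E) := by
  simp only [xor, realize_and, realize_or, realize_neg, xor_def, and_comm (a := ¬ φ.Realize M e E)]
@[simp] theorem realize_lt (s t : Term) :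
    (lt s t).Realize M e E ↔ M.lt (s.eval M e E) (t.eval M e E) := Iff.rfl
@[simp] theorem realize_allLe (x : ℕ) (t : Term) (φ : Formula) :
    (allLe x t φ).Realize M e E ↔ ∀ a, M.le a (t.eval M (Function.update e x a) E) →
      φ.Realize M (Function.update e x a) E := by
  change (∀ a, (imp (le (.var x) t) φ).Realize M (Function.update e x a) E) ↔ _
  simp
@[simp] theorem realize_exLe (x : ℕ) (t : Term) (φ : Formula) :
    (exLe x t φ).Realize M e E ↔ ∃ a, M.le a (t.eval M (Function.update e x a) E) ∧
      φ.Realize M (Function.update e x a) E := by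
  change (∃ a, (and (le (.var x) t) φ).Realize M (Function.update e x a) E) ↔ _
  simp
@[simp] theorem realize_allLt (x : ℕ) (t : Term) (φ : Formula) :
    (allLt x t φ).Realize M e E ↔ ∀ a, M.lt a (t.eval M (Function.update e x a) E) →
      φ.Realize M (Function.update e x a) E := by
  simp only [allLt, realize_allLe, realize_imp, realize_lt, Term.eval_var, Function.update_self]
  exact forall_congr' fun a => ⟨fun h h' => h h'.1 h', fun h _ => h⟩
@[simp] theorem realize_exLt (x : ℕ) (t : Term) (φ : Formula) :
    (exLt x t φ).Realize M e E ↔ ∃ a, M.lt a (t.eval M (Function.update e x a) E) ∧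
      φ.Realize M (Function.update e x a) E := by
  simp only [exLt, realize_exLe, realize_and, realize_lt, Term.eval_var, Function.update_self]
  exact exists_congr fun a => ⟨fun h => h.2, fun h => ⟨h.1.1, h⟩⟩
@[simp] theorem realize_exSLe (X : ℕ) (t : Term) (φ : Formula) :
    (exSLe X t φ).Realize M e E ↔ ∃ A, M.le (M.len A) (t.eval M e (Function.update E X A)) ∧
      φ.Realize M e (Function.update E X A) := by
  change (∃ A, (and (le (.len X) t) φ).Realize M e (Function.update E X A)) ↔ _
  simp
@[simp] theorem realize_exSUnique (X Y : ℕ) (φ : Formula) :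
    (exSUnique X Y φ).Realize M e E ↔ ∃ B, ∀ A,
      (φ.Realize M e (Function.update (Function.update E Y B) X A) ↔
        Function.update (Function.update E Y B) X A X =
          Function.update (Function.update E Y B) X A Y) := by
  change (∃ B, ∀ A, (iff φ (eqS X Y)).Realize M e
    (Function.update (Function.update E Y B) X A)) ↔ _
  simp only [realize_iff, realize_eqS]

end Realize

/-- The truth value of a formula depends only on the values of its free variables. -/
theorem realize_congr {M : Struct} (φ : Formula) : ∀ {e e' : ℕ → M.Num} {E E' : ℕ → M.Str},
    (∀ x ∈ φ.freeNum, e x = e' x) → (∀ X ∈ φ.freeStr, E X = E' X) →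
    (φ.Realize M e E ↔ φ.Realize M e' E') := by
  induction φ with
  | eqN s t =>
    intro e e' E E' he hE
    simp only [realize_eqN]
    rw [s.eval_congr (fun x h => he x (by simp [freeNum, h])) fun x h => hE x (by simp [freeStr, h]),
      t.eval_congr (fun x h => he x (by simp [freeNum, h])) fun x h => hE x (by simp [freeStr, h])]
  | eqS X Y =>
    intro e e' E E' _ hE
    simp only [realize_eqS]
    rw [hE X (by simp [freeStr]), hE Y (by simp [freeStr])]
  | le s t =>
    intro e e' E E' he hE
    simp only [realize_le]
    rw [s.eval_congr (fun x h => he x (by simp [freeNum, h])) fun x h => hE x (by simp [freeStr, h]),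
      t.eval_congr (fun x h => he x (by simp [freeNum, h])) fun x h => hE x (by simp [freeStr, h])]
  | mem t X =>
    intro e e' E E' he hE
    simp only [realize_mem]
    rw [t.eval_congr (fun x h => he x (by simp [freeNum, h])) fun x h => hE x (by simp [freeStr, h]),
      hE X (by simp [freeStr])]
  | neg φ ih => intro e e' E E' he hE; exact not_congr (ih he hE)
  | and φ ψ h₁ h₂ =>
    intro e e' E E' he hE
    exact and_congr
      (h₁ (fun x h => he x (by simp [freeNum, h])) fun x h => hE x (by simp [freeStr, h]))
      (h₂ (fun x h => he x (by simp [freeNum, h])) fun x h => hE x (by simp [freeStr, h]))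
  | or φ ψ h₁ h₂ =>
    intro e e' E E' he hE
    exact or_congr
      (h₁ (fun x h => he x (by simp [freeNum, h])) fun x h => hE x (by simp [freeStr, h]))
      (h₂ (fun x h => he x (by simp [freeNum, h])) fun x h => hE x (by simp [freeStr, h]))
  | allN x φ ih =>
    intro e e' E E' he hE
    refine forall_congr' fun a => ih (fun y hy => ?_) hE
    by_cases h : y = x
    · subst h; simp
    · simp only [Function.update_of_ne h]; exact he y (by simp [freeNum, h, hy])
  | exN x φ ih =>
    intro e e' E E' he hE
    refine exists_congr fun a => ih (fun y hy => ?_) hE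
    by_cases h : y = x
    · subst h; simp
    · simp only [Function.update_of_ne h]; exact he y (by simp [freeNum, h, hy])
  | allS X φ ih =>
    intro e e' E E' he hE
    refine forall_congr' fun a => ih he (fun y hy => ?_)
    by_cases h : y = X
    · subst h; simp
    · simp only [Function.update_of_ne h]; exact hE y (by simp [freeStr, h, hy])
  | exS X φ ih =>
    intro e e' E E' he hE
    refine exists_congr fun a => ih he (fun y hy => ?_)
    by_cases h : y = X
    · subst h; simp
    · simp only [Function.update_of_ne h]; exact hE y (by simp [freeStr, h, hy])

namespace IsSigmaB0

variable {φ ψ : Formula}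

theorem imp (hφ : φ.IsSigmaB0) (hψ : ψ.IsSigmaB0) : (φ.imp ψ).IsSigmaB0 := hφ.neg.or hψ

theorem iff (hφ : φ.IsSigmaB0) (hψ : ψ.IsSigmaB0) : (φ.iff ψ).IsSigmaB0 :=
  (hφ.imp hψ).and (hψ.imp hφ)

theorem xor (hφ : φ.IsSigmaB0) (hψ : ψ.IsSigmaB0) : (φ.xor ψ).IsSigmaB0 :=
  (hφ.and hψ.neg).or (hφ.neg.and hψ)

theorem lt (s t : Term) : (Formula.lt s t).IsSigmaB0 := (IsSigmaB0.le s t).and (eqN s t).neg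

theorem allLt {x : ℕ} {t : Term} (hx : x ∉ t.numVars) (hφ : φ.IsSigmaB0) :
    (Formula.allLt x t φ).IsSigmaB0 := .allLe hx ((lt _ _).imp hφ)

theorem exLt {x : ℕ} {t : Term} (hx : x ∉ t.numVars) (hφ : φ.IsSigmaB0) :
    (Formula.exLt x t φ).IsSigmaB0 := .exLe hx ((lt _ _).and hφ)

end IsSigmaB0

end Formula

/-! ### Consequences of `V⁰` in an arbitrary model -/

open Term Formula

namespace Struct

/-- `M` is a model of the theory axiomatized by `T`. -/
def Models (M : Struct) (T : Set Formula) : Prop := ∀ ψ ∈ T, M.Satisfies ψ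

theorem Models.mono {M : Struct} {S T : Set Formula} (h : M.Models T) (hST : S ⊆ T) : M.Models S :=
  fun ψ hψ => h ψ (hST hψ)

/-- The content of the axioms 2-BASIC in a structure. -/
structure Basic (M : Struct) : Prop where
  add_one_ne : ∀ a, M.add a M.one ≠ M.zero
  add_one_inj : ∀ a b, M.add a M.one = M.add b M.one → a = b
  add_zero : ∀ a, M.add a M.zero = a
  add_add_one : ∀ a b, M.add a (M.add b M.one) = M.add (M.add a b) M.one
  mul_zero : ∀ a, M.mul a M.zero = M.zero
  mul_add_one : ∀ a b, M.mul a (M.add b M.one) = M.add (M.mul a b) a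
  le_antisymm : ∀ a b, M.le a b ∧ M.le b a → a = b
  le_add : ∀ a b, M.le a (M.add a b)
  zero_le : ∀ a, M.le M.zero a
  le_total : ∀ a b, M.le a b ∨ M.le b a
  le_iff_lt : ∀ a b, M.le a b ↔ M.lt a (M.add b M.one)
  pred : ∀ a, a ≠ M.zero → ∃ b, M.le b a ∧ M.add b M.one = a
  lt_len : ∀ a A, M.mem a A → M.lt a (M.len A)
  mem_of_len : ∀ a A, M.add a M.one = M.len A → M.mem a A
  ext : ∀ A B, (M.len A = M.len B ∧ ∀ a, M.lt a (M.len A) → (M.mem a A ↔ M.mem a B)) → A = B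

theorem models_twoBasic_iff (M : Struct) : M.Models twoBasic ↔ M.Basic := by
  have key : M.Models twoBasic ↔ ∀ (a b : M.Num) (A B : M.Str), M.add a M.one ≠ M.zero ∧
      (M.add a M.one = M.add b M.one → a = b) ∧ M.add a M.zero = a ∧
      M.add a (M.add b M.one) = M.add (M.add a b) M.one ∧ M.mul a M.zero = M.zero ∧
      M.mul a (M.add b M.one) = M.add (M.mul a b) a ∧ (M.le a b ∧ M.le b a → a = b) ∧
      M.le a (M.add a b) ∧ M.le M.zero a ∧ (M.le a b ∨ M.le b a) ∧
      (M.le a b ↔ M.lt a (M.add b M.one)) ∧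
      (a ≠ M.zero → ∃ b, M.le b a ∧ M.add b M.one = a) ∧
      (M.mem b A → M.lt b (M.len A)) ∧ (M.add b M.one = M.len A → M.mem b A) ∧
      ((M.len A = M.len B ∧ ∀ a, M.lt a (M.len A) → (M.mem a A ↔ M.mem a B)) → A = B) := by
    simp only [Models, twoBasic, Set.mem_insert_iff, Set.mem_singleton_iff, forall_eq_or_imp,
      forall_eq, Satisfies, ← forall_and]
    refine ⟨fun h a b A B => ?_, fun h e E => ?_⟩
    · simpa [-not_and, -and_imp] using
        h (fun i => if i = 0 then a else b) (fun i => if i = 0 then A else B)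
    · simpa [-not_and, -and_imp] using h (e 0) (e 1) (E 0) (E 1)
  rw [key]
  obtain ⟨A₀⟩ := M.str_nonempty
  constructor
  · intro h
    constructor
    · exact fun a => (h a a A₀ A₀).1
    · exact fun a b => (h a b A₀ A₀).2.1
    · exact fun a => (h a a A₀ A₀).2.2.1
    · exact fun a b => (h a b A₀ A₀).2.2.2.1
    · exact fun a => (h a a A₀ A₀).2.2.2.2.1
    · exact fun a b => (h a b A₀ A₀).2.2.2.2.2.1
    · exact fun a b => (h a b A₀ A₀).2.2.2.2.2.2.1
    · exact fun a b => (h a b A₀ A₀).2.2.2.2.2.2.2.1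
    · exact fun a => (h a a A₀ A₀).2.2.2.2.2.2.2.2.1
    · exact fun a b => (h a b A₀ A₀).2.2.2.2.2.2.2.2.2.1
    · exact fun a b => (h a b A₀ A₀).2.2.2.2.2.2.2.2.2.2.1
    · exact fun a => (h a a A₀ A₀).2.2.2.2.2.2.2.2.2.2.2.1
    · exact fun a A => (h a a A A₀).2.2.2.2.2.2.2.2.2.2.2.2.1
    · exact fun a A => (h a a A A₀).2.2.2.2.2.2.2.2.2.2.2.2.2.1
    · exact fun A B => (h M.zero M.zero A B).2.2.2.2.2.2.2.2.2.2.2.2.2.2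
  · intro h a b A B
    exact ⟨h.1 a, h.2 a b, h.3 a, h.4 a b, h.5 a, h.6 a b, h.7 a b, h.8 a b, h.9 a, h.10 a b,
      h.11 a b, h.12 a, h.13 b A, h.14 b A, h.15 A B⟩

namespace Models

variable {M : Struct}

theorem basic (hM : M.Models V0) : M.Basic :=
  (models_twoBasic_iff M).1 (hM.mono Set.subset_union_left)

/-- `Σ^B_0`-comprehension, without restrictions on the variables: the bound is an element of the
model, and the parameters of `φ` are given by the assignment. -/
theorem comprehension (hM : M.Models V0) {φ : Formula} (hφ : φ.IsSigmaB0) (z : ℕ)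
    (e : ℕ → M.Num) (E : ℕ → M.Str) (b : M.Num) :
    ∃ A, M.le (M.len A) b ∧ ∀ a, M.lt a b →
      (M.mem a A ↔ φ.Realize M (Function.update e z a) E) := by
  -- The instance of the scheme with a bound `y` and a string variable `X` that are fresh for `φ`.
  obtain ⟨y, hy⟩ := Infinite.exists_notMem_finset (insert z φ.freeNum)
  obtain ⟨X, hX⟩ := Infinite.exists_notMem_finset φ.freeStr
  simp only [Finset.mem_insert, not_or] at hy
  have h := hM _ (Or.inr ⟨φ, y, z, X, hφ, hy.1, hX, rfl⟩) (Function.update e y b) E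
  simp only [realize_exSLe, eval_var, Function.update_self, realize_allLt, realize_iff,
    realize_mem, Function.update_of_ne hy.1] at h
  obtain ⟨A, hA, h⟩ := h
  refine ⟨A, hA, fun a ha => (h a ha).trans (realize_congr φ (fun x hx => ?_) fun Y hY => ?_)⟩
  · by_cases hxz : x = z
    · subst hxz; simp
    · rw [Function.update_of_ne hxz, Function.update_of_ne hxz, Function.update_of_ne]
      rintro rfl; exact hy.2 hx
  · rw [Function.update_of_ne]; rintro rfl; exact hX hY

theorem le_refl (hM : M.Models V0) (a : M.Num) : M.le a a := (hM.basic.le_total a a).elim id id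

theorem not_lt_zero (hM : M.Models V0) (a : M.Num) : ¬ M.lt a M.zero :=
  fun h => h.2 (hM.basic.le_antisymm _ _ ⟨h.1, hM.basic.zero_le a⟩)

theorem le_of_succ_le_succ (hM : M.Models V0) {a b : M.Num}
    (h : M.le (M.add a M.one) (M.add b M.one)) : M.le a b := by
  have B := hM.basic
  by_cases hab : a = b
  · exact hab ▸ hM.le_refl a
  have h' : M.le (M.add a M.one) b :=
    (B.le_iff_lt _ _).2 ⟨h, fun h => hab (B.add_one_inj _ _ h)⟩
  refine (B.le_total a b).elim id fun hba => ?_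
  have h₁ := (B.le_iff_lt _ _).1 hba
  exact absurd (B.le_antisymm _ _ ⟨h₁.1, h'⟩) h₁.2

theorem succ_le_of_lt (hM : M.Models V0) {a b : M.Num} (h : M.lt a b) :
    M.le (M.add a M.one) b := by
  have B := hM.basic
  refine (B.le_total _ _).elim id fun hba => ?_
  by_cases hb : b = M.add a M.one
  · exact hb ▸ hM.le_refl _
  · exact absurd (B.le_antisymm _ _ ⟨h.1, (B.le_iff_lt _ _).2 ⟨hba, hb⟩⟩) h.2

theorem le_succ_iff (hM : M.Models V0) {a b : M.Num} :
    M.le a (M.add b M.one) ↔ M.le a b ∨ a = M.add b M.one := by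
  have B := hM.basic
  constructor
  · intro h
    by_cases hab : a = M.add b M.one
    · exact Or.inr hab
    · exact Or.inl ((B.le_iff_lt _ _).2 ⟨h, hab⟩)
  · rintro (h | rfl)
    · exact ((B.le_iff_lt _ _).1 h).1
    · exact hM.le_refl _

/-- Induction on the elements of the set `{z | ∀ i ≤ z, i ∈ A}`: its length `y + 1` would exhibit a
number `y + 1 ≤ b` outside `A`. -/
theorem mem_of_mem_zero_of_succ (hM : M.Models V0) (A : M.Str) (b : M.Num)
    (h₀ : M.mem M.zero A)
    (hs : ∀ a, M.lt a b → M.mem a A → M.mem (M.add a M.one) A) : M.mem b A := by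
  have B := hM.basic
  obtain ⟨S, hSlen, hS⟩ := hM.comprehension
    (φ := allLe 1 (var 0) (Formula.mem (var 1) 0)) (.allLe (by decide) (.mem _ _)) 0
    (fun _ => b) (fun _ => A) (M.add b M.one)
  simp only [realize_allLe, eval_var, realize_mem, Function.update_self, ne_eq, zero_ne_one,
    not_false_eq_true, Function.update_of_ne] at hS
  have hS₀ : M.mem M.zero S := by
    refine (hS _ ((B.le_iff_lt _ _).1 (B.zero_le b))).2 fun i hi => ?_
    rwa [B.le_antisymm _ _ ⟨hi, B.zero_le i⟩]
  have hne : M.len S ≠ M.zero := fun h => hM.not_lt_zero _ (h ▸ B.lt_len _ _ hS₀)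
  obtain ⟨y, -, hy⟩ := B.pred _ hne
  have hyb : M.le y b := hM.le_of_succ_le_succ (hy ▸ hSlen)
  have hyS := (hS y ((B.le_iff_lt _ _).1 hyb)).1 (B.mem_of_len _ _ hy)
  by_cases hyb' : y = b
  · exact hyb' ▸ hyS y (hM.le_refl y)
  · have hlt : M.lt y b := ⟨hyb, hyb'⟩
    have : M.mem (M.add y M.one) S := by
      refine (hS _ ((B.le_iff_lt _ _).1 (hM.succ_le_of_lt hlt))).2 fun i hi => ?_
      rcases hM.le_succ_iff.1 hi with hi | rfl
      · exact hyS i hi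
      · exact hs y hlt (hyS y (hM.le_refl y))
    exact absurd hy (B.lt_len _ _ this).2

/-- Induction for a `Σ^B_0` formula up to `b`. -/
theorem induction (hM : M.Models V0) {φ : Formula} (hφ : φ.IsSigmaB0) (z : ℕ)
    (e : ℕ → M.Num) (E : ℕ → M.Str) {P : M.Num → Prop}
    (hP : ∀ a, φ.Realize M (Function.update e z a) E ↔ P a) (b : M.Num) (h₀ : P M.zero)
    (hs : ∀ a, M.lt a b → P a → P (M.add a M.one)) : P b := by
  have B := hM.basic
  obtain ⟨A, -, hA⟩ := hM.comprehension hφ z e E (M.add b M.one)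
  have hA' : ∀ a, M.le a b → (M.mem a A ↔ P a) := fun a ha =>
    (hA a ((B.le_iff_lt _ _).1 ha)).trans (hP a)
  refine (hA' b (hM.le_refl b)).1 (hM.mem_of_mem_zero_of_succ A b ?_ fun a ha h => ?_)
  · exact (hA' _ (B.zero_le b)).2 h₀
  · exact (hA' _ (hM.succ_le_of_lt ha)).2 (hs a ha ((hA' a ha.1).1 h))

theorem le_trans (hM : M.Models V0) {a b c : M.Num} (hab : M.le a b) (hbc : M.le b c) :
    M.le a c := by
  have B := hM.basic
  obtain ⟨A₀⟩ := M.str_nonempty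
  refine hM.induction (φ := imp (Formula.le (var 0) (var 2)) (Formula.le (var 1) (var 2)))
    ((IsSigmaB0.le _ _).imp (.le _ _)) 2 (fun i => if i = 0 then b else a) (fun _ => A₀)
    (P := fun c => M.le b c → M.le a c) (fun c => ?_) c ?_ (fun c _ ih h => ?_) hbc
  · simp
  · intro h
    rwa [← B.le_antisymm _ _ ⟨h, B.zero_le b⟩]
  · rcases hM.le_succ_iff.1 h with h | rfl
    · exact hM.le_succ_iff.2 (Or.inl (ih h))
    · exact hab

theorem lt_of_lt_of_le (hM : M.Models V0) {a b c : M.Num} (hab : M.lt a b) (hbc : M.le b c) :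
    M.lt a c :=
  ⟨hM.le_trans hab.1 hbc, by rintro rfl; exact hab.2 (hM.basic.le_antisymm _ _ ⟨hab.1, hbc⟩)⟩

theorem lt_of_le_of_lt (hM : M.Models V0) {a b c : M.Num} (hab : M.le a b) (hbc : M.lt b c) :
    M.lt a c :=
  ⟨hM.le_trans hab hbc.1, by rintro rfl; exact hbc.2 (hM.basic.le_antisymm _ _ ⟨hbc.1, hab⟩)⟩

theorem lt_succ_self (hM : M.Models V0) (a : M.Num) : M.lt a (M.add a M.one) :=
  (hM.basic.le_iff_lt _ _).1 (hM.le_refl a)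

theorem succ_le_succ (hM : M.Models V0) {a b : M.Num} (h : M.le a b) :
    M.le (M.add a M.one) (M.add b M.one) :=
  hM.succ_le_of_lt ((hM.basic.le_iff_lt _ _).1 h)

theorem zero_add (hM : M.Models V0) (a : M.Num) : M.add M.zero a = a := by
  have B := hM.basic
  obtain ⟨A₀⟩ := M.str_nonempty
  refine hM.induction (φ := eqN (0 + var 0) (var 0)) (.eqN _ _) 0 (fun _ => a) (fun _ => A₀)
    (P := fun a => M.add M.zero a = a) (fun a => by simp) a (B.add_zero _) fun a _ ih => ?_
  rw [B.add_add_one, ih]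

theorem succ_add (hM : M.Models V0) (a b : M.Num) :
    M.add (M.add a M.one) b = M.add (M.add a b) M.one := by
  have B := hM.basic
  obtain ⟨A₀⟩ := M.str_nonempty
  refine hM.induction (φ := eqN (var 1 + 1 + var 0) (var 1 + var 0 + 1)) (.eqN _ _) 0 (fun _ => a)
    (fun _ => A₀) (P := fun b => M.add (M.add a M.one) b = M.add (M.add a b) M.one)
    (fun b => by simp) b (by rw [B.add_zero, B.add_zero]) fun b _ ih => ?_
  rw [B.add_add_one, ih, B.add_add_one]

theorem add_comm (hM : M.Models V0) (a b : M.Num) : M.add a b = M.add b a := by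
  have B := hM.basic
  obtain ⟨A₀⟩ := M.str_nonempty
  refine hM.induction (φ := eqN (var 1 + var 0) (var 0 + var 1)) (.eqN _ _) 0 (fun _ => a)
    (fun _ => A₀) (P := fun b => M.add a b = M.add b a)
    (fun b => by simp) b (by rw [B.add_zero, hM.zero_add]) fun b _ ih => ?_
  rw [B.add_add_one, ih, hM.succ_add]

theorem le_two_mul (hM : M.Models V0) (a : M.Num) : M.le a (M.mul (M.add M.one M.one) a) := by
  have B := hM.basic
  obtain ⟨A₀⟩ := M.str_nonempty
  refine hM.induction (φ := Formula.le (var 0) ((1 + 1) * var 0)) (.le _ _) 0 (fun _ => a)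
    (fun _ => A₀) (P := fun a => M.le a (M.mul (M.add M.one M.one) a))
    (fun b => by simp) a (B.zero_le _) fun a _ ih => ?_
  rw [B.mul_add_one, B.add_add_one]
  exact hM.le_trans (hM.succ_le_succ ih) (hM.lt_succ_self _).1

theorem le_pair_right (hM : M.Models V0) (a b : M.Num) : M.le b (M.pair a b) := by
  rw [pair, hM.add_comm]
  exact hM.le_trans (hM.le_two_mul b) (hM.basic.le_add _ _)

theorem len_le_len (hM : M.Models V0) {A C : M.Str} (h : ∀ a, M.mem a A → M.mem a C) :
    M.le (M.len A) (M.len C) := by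
  have B := hM.basic
  by_cases h₀ : M.len A = M.zero
  · rw [h₀]; exact B.zero_le _
  · obtain ⟨y, -, hy⟩ := B.pred _ h₀
    rw [← hy]
    exact hM.succ_le_of_lt (B.lt_len _ _ (h y (B.mem_of_len _ _ hy)))

theorem str_ext (hM : M.Models V0) {A C : M.Str} (h : ∀ a, M.mem a A ↔ M.mem a C) : A = C :=
  hM.basic.ext _ _ ⟨hM.basic.le_antisymm _ _ ⟨hM.len_le_len fun a => (h a).1,
    hM.len_le_len fun a => (h a).2⟩, fun a _ => h a⟩

end Models

end Struct

/-! ### The standard model -/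

theorem strLen_le_iff {X : Finset ℕ} {t : ℕ} : strLen X ≤ t ↔ ∀ x ∈ X, x < t := by
  simp [strLen, Finset.sup_le_iff]

theorem lt_strLen_of_mem {X : Finset ℕ} {x : ℕ} (h : x ∈ X) : x < strLen X :=
  strLen_le_iff.1 le_rfl x h

theorem standardModel_lt_iff {a b : ℕ} : standardModel.lt a b ↔ a < b :=
  (lt_iff_le_and_ne (a := a) (b := b)).symm

theorem standardModel_basic : standardModel.Basic where
  add_one_ne := Nat.succ_ne_zero
  add_one_inj _ _ h := Nat.succ_injective h
  add_zero := Nat.add_zero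
  add_add_one _ _ := rfl
  mul_zero := Nat.mul_zero
  mul_add_one _ _ := rfl
  le_antisymm _ _ h := Nat.le_antisymm h.1 h.2
  le_add := Nat.le_add_right
  zero_le := Nat.zero_le
  le_total := Nat.le_total
  le_iff_lt _ _ := Nat.lt_succ_iff.symm.trans standardModel_lt_iff.symm
  pred a h := ⟨Nat.pred a, Nat.pred_le a, Nat.succ_pred_eq_of_ne_zero h⟩
  lt_len _ _ h := standardModel_lt_iff.2 (lt_strLen_of_mem h)
  mem_of_len := by
    intro (a : ℕ) (A : Finset ℕ) (h : a + 1 = strLen A)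
    change a ∈ A
    by_contra hn
    have : strLen A ≤ a := strLen_le_iff.2 fun x hx => by
      have := lt_strLen_of_mem hx
      have hxa : x ≠ a := by rintro rfl; exact hn hx
      omega
    omega
  ext A C h := by
    obtain ⟨h, h'⟩ := h
    change strLen A = strLen C at h
    refine Finset.ext fun x => ⟨fun hx => ?_, fun hx => ?_⟩
    · exact (h' x (standardModel_lt_iff.2 (lt_strLen_of_mem hx))).1 hx
    · exact (h' x (standardModel_lt_iff.2 ((lt_strLen_of_mem hx).trans_eq h.symm))).2 hx

theorem standardModel_models_V0 : standardModel.Models V0 := by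
  rintro ψ (hψ | ⟨φ, y, z, X, -, hyz, hX, rfl⟩)
  · exact (Struct.models_twoBasic_iff _).2 standardModel_basic ψ hψ
  · intro e E
    classical
    let S : Finset ℕ :=
      (Finset.range (e y)).filter fun a => φ.Realize standardModel (Function.update e z a) E
    simp only [realize_exSLe, realize_allLt, realize_iff, realize_mem, eval_var,
      Function.update_self, Function.update_of_ne hyz]
    have hS : strLen S ≤ (e y : ℕ) := strLen_le_iff.2 fun x hx =>
      Finset.mem_range.1 (Finset.mem_filter.1 hx).1
    refine ⟨S, hS, fun a ha => ?_⟩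
    · have h : φ.Realize standardModel (Function.update e z a) (Function.update E X S) ↔
          φ.Realize standardModel (Function.update e z a) E :=
        realize_congr φ (fun _ _ => rfl) fun Y hY =>
          Function.update_of_ne (by rintro rfl; exact hX hY) _ _
      rw [h]
      exact Finset.mem_filter.trans
        (and_iff_right (Finset.mem_range.2 (standardModel_lt_iff.1 ha)))

/-! ### Matrix powering over `ℤ₂`: uniqueness in models of `V⁰` -/

namespace Struct

/-- The meaning in `M` of the formula `alpha2`: the list `Y` codes the first `k + 1` powers of the
`n × n` matrix `X` over `ℤ₂`, as witnessed by the prefix parities `Z`. -/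
def Alpha2 (M : Struct) (n k : M.Num) (X Y Z : M.Str) : Prop :=
  (∀ b, M.lt b (M.len Y) → M.mem b Y → ∃ l, M.le l k ∧ ∃ i, M.lt i n ∧ ∃ j, M.lt j n ∧
    b = M.pair l (M.pair i j)) ∧
  (∀ i, M.lt i n → ∀ j, M.lt j n → (M.mem (M.pair M.zero (M.pair i j)) Y ↔ i = j)) ∧
  ∀ l, M.lt l k → ∀ i, M.lt i n → ∀ j, M.lt j n →
    ¬ M.mem (M.pair l (M.pair i (M.pair j M.zero))) Z ∧
    (∀ b, M.lt b n → (M.mem (M.pair l (M.pair i (M.pair j (M.add b M.one)))) Z ↔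
      Xor (M.mem (M.pair i b) X ∧ M.mem (M.pair l (M.pair b j)) Y)
        (M.mem (M.pair l (M.pair i (M.pair j b))) Z))) ∧
    (M.mem (M.pair (M.add l M.one) (M.pair i j)) Y ↔
      M.mem (M.pair l (M.pair i (M.pair j n))) Z)

end Struct

/-- The formula `alpha2` with the string variables of index `y` and `z` in place of `Y` and `Z`. -/
def alpha2At (y z : ℕ) : Formula :=
  let n := var 0
  let k := var 1
  let l := var 2
  let i := var 3
  let j := var 4
  let b := var 5
  let Y (l i j : Term) : Formula := mem (pair l (pair i j)) y
  let Z (b : Term) : Formula := mem (pair l (pair i (pair j b))) z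
  and (allLt 5 (len y) (imp (mem b y)
      (exLe 2 k (exLt 3 n (exLt 4 n (eqN b (pair l (pair i j))))))))
  (and (allLt 3 n (allLt 4 n (iff (Y 0 i j) (eqN i j))))
    (allLt 2 k (allLt 3 n (allLt 4 n
      (and (neg (Z 0))
      (and (allLt 5 n (iff (Z (b + 1)) (xor (and (mem (pair i b) 0) (Y l b j)) (Z b))))
        (iff (Y (l + 1) i j) (Z n))))))))

theorem alpha2At_one_two : alpha2At 1 2 = alpha2 := rfl

theorem realize_alpha2At (M : Struct) (y z : ℕ) (e : ℕ → M.Num) (E : ℕ → M.Str) :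
    (alpha2At y z).Realize M e E ↔ M.Alpha2 (e 0) (e 1) (E 0) (E y) (E z) := by
  simp [alpha2At, Struct.Alpha2]

theorem isSigmaB0_alpha2At (y z : ℕ) : (alpha2At y z).IsSigmaB0 := by
  refine .and (.allLt (by simp [numVars]) (.imp (.mem _ _) (.exLe (by decide) (.exLt (by decide)
    (.exLt (by decide) (.eqN _ _)))))) (.and (.allLt (by decide) (.allLt (by decide)
    (.iff (.mem _ _) (.eqN _ _)))) (.allLt (by decide) (.allLt (by decide) (.allLt (by decide)
    (.and (.neg (.mem _ _)) (.and (.allLt (by decide) (.iff (.mem _ _)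
    (.xor (.and (.mem _ _) (.mem _ _)) (.mem _ _)))) (.iff (.mem _ _) (.mem _ _))))))))

/-- In a model of `V⁰`, the matrix list is determined: by induction on `l` the matrices with number
`l` agree, and in the step the prefix parities agree by induction on the length of the prefix. -/
theorem eq_of_alpha2 {M : Struct} (hM : M.Models V0) {n k : M.Num} {X Y Z Y' Z' : M.Str}
    (h : M.Alpha2 n k X Y Z) (h' : M.Alpha2 n k X Y' Z') : Y = Y' := by
  have B := hM.basic
  obtain ⟨hf, h₀, hs⟩ := h
  obtain ⟨hf', h₀', hs'⟩ := h'
  have key : ∀ l, M.le l k → ∀ i, M.lt i n → ∀ j, M.lt j n →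
      (M.mem (M.pair l (M.pair i j)) Y ↔ M.mem (M.pair l (M.pair i j)) Y') := by
    intro l hl
    refine hM.induction (φ := allLt 1 (var 3) (allLt 2 (var 3) (iff
        (mem (pair (var 0) (pair (var 1) (var 2))) 0) (mem (pair (var 0) (pair (var 1) (var 2))) 1))))
      (.allLt (by decide) (.allLt (by decide) (.iff (.mem _ _) (.mem _ _)))) 0 (fun _ => n)
      (fun i => if i = 0 then Y else Y')
      (P := fun l => ∀ i, M.lt i n → ∀ j, M.lt j n →
        (M.mem (M.pair l (M.pair i j)) Y ↔ M.mem (M.pair l (M.pair i j)) Y'))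
      (fun a => by simp) l (fun i hi j hj => (h₀ i hi j hj).trans (h₀' i hi j hj).symm)
      fun l hlt ih i hi j hj => ?_
    have hlk := hM.lt_of_lt_of_le hlt hl
    obtain ⟨z₀, zs, zn⟩ := hs l hlk i hi j hj
    obtain ⟨z₀', zs', zn'⟩ := hs' l hlk i hi j hj
    rw [zn, zn']
    refine hM.induction (φ := iff
        (mem (pair (var 1) (pair (var 2) (pair (var 3) (var 0)))) 0)
        (mem (pair (var 1) (pair (var 2) (pair (var 3) (var 0)))) 1))
      (.iff (.mem _ _) (.mem _ _)) 0 (fun v => if v = 1 then l else if v = 2 then i else j)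
      (fun i => if i = 0 then Z else Z')
      (P := fun b => M.mem (M.pair l (M.pair i (M.pair j b))) Z ↔
        M.mem (M.pair l (M.pair i (M.pair j b))) Z')
      (fun a => by simp) n (iff_of_false z₀ z₀') fun b hb ihb => ?_
    rw [zs b hb, zs' b hb, ihb, ih b hb j hj]
  refine hM.str_ext fun b => ⟨fun hb => ?_, fun hb => ?_⟩
  · obtain ⟨l, hl, i, hi, j, hj, rfl⟩ := hf b (B.lt_len _ _ hb) hb
    exact (key l hl i hi j hj).1 hb
  · obtain ⟨l, hl, i, hi, j, hj, rfl⟩ := hf' b (B.lt_len _ _ hb) hb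
    exact (key l hl i hi j hj).2 hb

/-! ### Matrix powering over `ℤ₂` in the standard model -/

theorem pairNat_injective {x y x' y' : ℕ} (h : pairNat x y = pairNat x' y') :
    x = x' ∧ y = y' := by
  have key : ∀ {x y x' y' : ℕ}, x + y < x' + y' → pairNat x y < pairNat x' y' := by
    intro x y x' y' h
    have h₁ : (x + y + 1) * (x + y + 1 + 1) ≤ (x' + y') * (x' + y' + 1) :=
      Nat.mul_le_mul h (Nat.succ_le_succ h)
    have h₂ : (x + y + 1) * (x + y + 1 + 1) = (x + y) * (x + y + 1) + 2 * (x + y) + 2 := by ring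
    simp only [pairNat]
    omega
  have hs : x + y = x' + y' := by
    rcases lt_trichotomy (x + y) (x' + y') with hlt | heq | hlt
    · exact absurd h (key hlt).ne
    · exact heq
    · exact absurd h (key hlt).ne'
  simp only [pairNat, hs] at h
  omega

theorem pairNat_le_pairNat {x y x' y' : ℕ} (hx : x ≤ x') (hy : y ≤ y') :
    pairNat x y ≤ pairNat x' y' := by
  unfold pairNat; gcongr

theorem pairNat_lt_pairNat_left {x y x' y' : ℕ} (hx : x < x') (hy : y ≤ y') :
    pairNat x y < pairNat x' y' :=
  lt_of_le_of_ne (pairNat_le_pairNat hx.le hy) fun h => hx.ne (pairNat_injective h).1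

theorem pairNat_lt_pairNat_right {x y x' y' : ℕ} (hx : x ≤ x') (hy : y < y') :
    pairNat x y < pairNat x' y' :=
  lt_of_le_of_ne (pairNat_le_pairNat hx hy.le) fun h => hy.ne (pairNat_injective h).2

theorem mem_pow2_iff {n k : ℕ} {X : Finset ℕ} {a : ℕ} :
    a ∈ pow2 n k X ↔ ∃ i j : Fin n, (matrix2 n X ^ k) i j = 1 ∧ a = pairNat i j := by
  simp only [pow2, Finset.mem_image, Finset.mem_filter, Finset.mem_univ, true_and, Prod.exists]
  exact exists_congr fun i => exists_congr fun j => and_congr_right fun _ => eq_comm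

theorem mem_powSeq2_iff {n k : ℕ} {X : Finset ℕ} {a : ℕ} :
    a ∈ powSeq2 n k X ↔ ∃ l ≤ k, ∃ i j : Fin n, (matrix2 n X ^ l) i j = 1 ∧
      a = pairNat l (pairNat i j) := by
  simp only [powSeq2, Finset.mem_biUnion, Finset.mem_range, Finset.mem_image, mem_pow2_iff,
    Nat.lt_succ_iff]
  constructor
  · rintro ⟨l, hl, _, ⟨i, j, h, rfl⟩, rfl⟩; exact ⟨l, hl, i, j, h, rfl⟩
  · rintro ⟨l, hl, i, j, h, rfl⟩; exact ⟨l, hl, _, ⟨i, j, h, rfl⟩, rfl⟩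

theorem pair_mem_powSeq2_iff {n k l : ℕ} {X : Finset ℕ} (hl : l ≤ k) (i j : Fin n) :
    pairNat l (pairNat i j) ∈ powSeq2 n k X ↔ (matrix2 n X ^ l) i j = 1 := by
  rw [mem_powSeq2_iff]
  constructor
  · rintro ⟨l', -, i', j', h, heq⟩
    obtain ⟨rfl, heq'⟩ := pairNat_injective heq
    obtain ⟨hi, hj⟩ := pairNat_injective heq'
    obtain rfl := Fin.ext hi
    obtain rfl := Fin.ext hj
    exact h
  · exact fun h => ⟨l, hl, i, j, h, rfl⟩

open Classical in
/-- The number of `b' < b` with `p b'`, modulo two. -/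
noncomputable def prefixParity (p : ℕ → Prop) (b : ℕ) : ZMod 2 :=
  ∑ b' ∈ Finset.range b, if p b' then 1 else 0

theorem prefixParity_succ (p : ℕ → Prop) (b : ℕ) :
    prefixParity p (b + 1) = 1 ↔ Xor (p b) (prefixParity p b = 1) := by
  have key : ∀ s : ZMod 2, (s + 1 = 1 ↔ ¬ s = 1) := by decide
  rw [prefixParity, Finset.sum_range_succ, ← prefixParity]
  by_cases h : p b
  · simp [h, key, xor_def]
  · simp [h, xor_def]

/-- The number `a` is some `⟨l, ⟨i, ⟨j, b⟩⟩⟩` such that the number of `b' < b` with `X(i, b')` and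
`Y(l, b', j)` is odd. -/
def IsParityBit (n k : ℕ) (X Y : Finset ℕ) (a : ℕ) : Prop :=
  ∃ l i j b, l < k ∧ i < n ∧ j < n ∧ b ≤ n ∧ a = pairNat l (pairNat i (pairNat j b)) ∧
    prefixParity (fun b' => pairNat i b' ∈ X ∧ pairNat l (pairNat b' j) ∈ Y) b = 1

open Classical in
/-- The prefix parities for the matrix list `Y`. -/
noncomputable def parityTable (n k : ℕ) (X Y : Finset ℕ) : Finset ℕ :=
  (Finset.range (pairNat k (pairNat n (pairNat n n)))).filter (IsParityBit n k X Y)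

open Classical in
theorem mem_parityTable_iff {n k l i j b : ℕ} {X Y : Finset ℕ} (hl : l < k) (hi : i < n)
    (hj : j < n) (hb : b ≤ n) :
    pairNat l (pairNat i (pairNat j b)) ∈ parityTable n k X Y ↔
      prefixParity (fun b' => pairNat i b' ∈ X ∧ pairNat l (pairNat b' j) ∈ Y) b = 1 := by
  rw [parityTable, Finset.mem_filter, Finset.mem_range]
  constructor
  · rintro ⟨-, l', i', j', b', -, -, -, -, heq, h⟩
    obtain ⟨rfl, heq₁⟩ := pairNat_injective heq
    obtain ⟨rfl, heq₂⟩ := pairNat_injective heq₁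
    obtain ⟨rfl, rfl⟩ := pairNat_injective heq₂
    exact h
  · exact fun h => ⟨pairNat_lt_pairNat_left hl (pairNat_le_pairNat hi.le
      (pairNat_le_pairNat hj.le hb)), l, i, j, b, hl, hi, hj, hb, rfl, h⟩

open Classical in
theorem strLen_parityTable_le (n k : ℕ) (X Y : Finset ℕ) :
    strLen (parityTable n k X Y) ≤ pairNat k (pairNat n (pairNat n n)) :=
  strLen_le_iff.2 fun _ hx => Finset.mem_range.1 (Finset.mem_filter.1 hx).1

theorem matrix2_pow_succ_apply (n l : ℕ) (X : Finset ℕ) (i j : Fin n) :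
    (matrix2 n X ^ (l + 1)) i j = ∑ b : Fin n,
      if pairNat i b ∈ X ∧ (matrix2 n X ^ l) b j = 1 then 1 else 0 := by
  rw [pow_succ', Matrix.mul_apply]
  refine Finset.sum_congr rfl fun b _ => ?_
  have key : ∀ s : ZMod 2, s = if s = 1 then 1 else 0 := by decide
  generalize (matrix2 n X ^ l) b j = s
  by_cases h : pairNat i b ∈ X
  · simp only [matrix2, h, if_true, one_mul, true_and]; exact key s
  · simp only [matrix2, h, if_false, zero_mul, false_and]

open Classical in
theorem standardModel_alpha2 (n k : ℕ) (X : Finset ℕ) :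
    standardModel.Alpha2 n k X (powSeq2 n k X) (parityTable n k X (powSeq2 n k X)) := by
  refine ⟨fun b _ hb => ?_, fun (i : ℕ) hi (j : ℕ) hj => ?_,
    fun (l : ℕ) hl (i : ℕ) hi (j : ℕ) hj => ⟨?_, fun (b : ℕ) hb => ?_, ?_⟩⟩
  · obtain ⟨l, hl, i, j, -, rfl⟩ := mem_powSeq2_iff.1 hb
    exact ⟨l, hl, (i : ℕ), standardModel_lt_iff.2 i.2, (j : ℕ), standardModel_lt_iff.2 j.2, rfl⟩
  · have hi := standardModel_lt_iff.1 hi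
    have hj := standardModel_lt_iff.1 hj
    refine (pair_mem_powSeq2_iff (X := X) (Nat.zero_le k) ⟨i, hi⟩ ⟨j, hj⟩).trans ?_
    rw [pow_zero, Matrix.one_apply]
    split_ifs with h
    · exact iff_of_true rfl (congrArg Fin.val h)
    · exact iff_of_false zero_ne_one fun h' => h (Fin.ext h')
  · have hl := standardModel_lt_iff.1 hl
    have hi := standardModel_lt_iff.1 hi
    have hj := standardModel_lt_iff.1 hj
    refine mt (mem_parityTable_iff hl hi hj (Nat.zero_le n)).1 ?_
    simp [prefixParity]
  · have hl := standardModel_lt_iff.1 hl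
    have hi := standardModel_lt_iff.1 hi
    have hj := standardModel_lt_iff.1 hj
    have hb := standardModel_lt_iff.1 hb
    exact (mem_parityTable_iff hl hi hj (Nat.succ_le_of_lt hb)).trans
      ((prefixParity_succ _ b).trans (iff_of_eq (congrArg (Xor _)
        (propext (mem_parityTable_iff hl hi hj hb.le).symm))))
  · have hl := standardModel_lt_iff.1 hl
    have hi := standardModel_lt_iff.1 hi
    have hj := standardModel_lt_iff.1 hj
    refine (pair_mem_powSeq2_iff (X := X) (Nat.succ_le_of_lt hl) ⟨i, hi⟩ ⟨j, hj⟩).trans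
      (Iff.trans (iff_of_eq (congrArg (· = 1) ?_)) (mem_parityTable_iff hl hi hj le_rfl).symm)
    rw [matrix2_pow_succ_apply, prefixParity, Finset.sum_range]
    refine Finset.sum_congr rfl fun b _ => ?_
    simp only [← pair_mem_powSeq2_iff hl.le b ⟨j, hj⟩]
    congr

/-! ### Definability in `V⊕L` -/

/-- A formula with output variable `1` defines `F` in `T` if it has an output in every model of `T` and
at most one output in every model of `V⁰`, and if the value of `F` satisfies it in the standard model:
there, a model of `V⁰`, uniqueness yields the other direction of the graph condition. -/
theorem stringDefinable_of_unique {T : Set Formula} (hT : V0 ⊆ T) {φ : Formula}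
    {F : (Fin 2 → ℕ) → (Fin 1 → Finset ℕ) → Finset ℕ}
    (hφ : φ.IsSigmaB1) (hnum : φ.freeNum ⊆ Finset.range 2) (hstr : φ.freeStr ⊆ Finset.range 2)
    (hex : ∀ M : Struct, M.Models T → ∀ e E, ∃ A, φ.Realize M e (Function.update E 1 A))
    (huniq : ∀ M : Struct, M.Models V0 → ∀ e E A A', φ.Realize M e (Function.update E 1 A) →
      φ.Realize M e (Function.update E 1 A') → A = A')
    (hstd : ∀ (e : ℕ → ℕ) (E : ℕ → Finset ℕ), φ.Realize standardModel e
      (Function.update E 1 (F (fun i => e i) (fun i => E i)))) :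
    StringDefinable SigmaB1 T 2 1 F := by
  refine ⟨φ, hφ, hnum, hstr, fun M hM e E => ?_, fun e E => ?_⟩
  · obtain ⟨A, hA⟩ := hex M hM e E
    have hfree : ∀ B C, φ.Realize M e (Function.update (Function.update E 2 B) 1 C) ↔
        φ.Realize M e (Function.update E 1 C) := fun B C =>
      realize_congr φ (fun _ _ => rfl) fun x hx => by
        have hx : x ≠ 2 := (Finset.mem_range.1 (hstr hx)).ne
        by_cases hx' : x = 1
        · subst hx'; simp
        · simp [hx, hx']
    rw [realize_exSUnique]
    refine ⟨A, fun C => (hfree A C).trans ?_⟩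
    rw [Function.update_self, Function.update_of_ne (by decide), Function.update_self]
    exact ⟨fun hC => huniq M (Struct.Models.mono hM hT) e E C A hC hA, fun h => h ▸ hA⟩
  · have h := hstd e E
    constructor
    · intro hE
      have hE' : Function.update E 1 (F (fun i => e i) (fun i => E i)) = E := by
        rw [← hE, Function.update_eq_self]
      exact hE' ▸ h
    · intro hE
      have hE' : φ.Realize standardModel e (Function.update E 1 (E 1)) :=
        (Function.update_eq_self 1 E).symm ▸ hE
      exact huniq standardModel standardModel_models_V0 e E _ _ hE' h

/-- The formula `∃ Z ≤ ⟨k, ⟨n, ⟨n, n⟩⟩⟩, α(n, k, X, Y, Z)` that defines `PowSeq₂`. -/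
def powSeq2Formula : Formula :=
  exSLe 2 (pair (var 1) (pair (var 0) (pair (var 0) (var 0)))) (alpha2At 1 2)

theorem realize_powSeq2Formula (M : Struct) (e : ℕ → M.Num) (E : ℕ → M.Str) (Y : M.Str) :
    powSeq2Formula.Realize M e (Function.update E 1 Y) ↔
      ∃ Z, M.le (M.len Z) (M.pair (e 1) (M.pair (e 0) (M.pair (e 0) (e 0)))) ∧
        M.Alpha2 (e 0) (e 1) (E 0) Y Z := by
  simp [powSeq2Formula, realize_alpha2At]

theorem exists_alpha2 {M : Struct} (hM : M.Models VParityL) (e : ℕ → M.Num) (E : ℕ → M.Str) :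
    ∃ Y Z, M.le (M.len Y) (M.pair (e 1) (M.pair (e 0) (e 0))) ∧
      M.le (M.len Z) (M.pair (e 1) (M.pair (e 0) (M.pair (e 0) (e 0)))) ∧
      M.Alpha2 (e 0) (e 1) (E 0) Y Z := by
  have h := hM PS2 (Or.inr rfl) e E
  simp only [PS2, ← alpha2At_one_two, realize_exSLe, realize_alpha2At] at h
  simpa using h

theorem V0_subset_VParityL : V0 ⊆ VParityL :=
  Set.subset_union_left.trans Set.subset_union_left

theorem stringDefinable_powSeq2 : StringDefinable SigmaB1 VParityL 2 1
    (fun x X => powSeq2 (x 0) (x 1) (X 0)) := by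
  refine stringDefinable_of_unique V0_subset_VParityL (φ := powSeq2Formula)
    (.exSLe (by decide) (.sigmaB0 (isSigmaB0_alpha2At 1 2))) (by decide +kernel) (by decide +kernel)
    (fun M hM e E => ?_) (fun M hM e E A A' h h' => ?_) (fun e E => ?_)
  · obtain ⟨Y, Z, -, hZ, h⟩ := exists_alpha2 hM e E
    exact ⟨Y, (realize_powSeq2Formula M e E Y).2 ⟨Z, hZ, h⟩⟩
  · obtain ⟨Z, -, h⟩ := (realize_powSeq2Formula M e E A).1 h
    obtain ⟨Z', -, h'⟩ := (realize_powSeq2Formula M e E A').1 h'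
    exact eq_of_alpha2 hM h h'
  · exact (realize_powSeq2Formula standardModel e E _).2
      ⟨parityTable (e 0) (e 1) (E 0) (powSeq2 (e 0) (e 1) (E 0)),
        strLen_parityTable_le (e 0) (e 1) (E 0) (powSeq2 (e 0) (e 1) (E 0)), standardModel_alpha2 (e 0) (e 1) (E 0)⟩

/-- `Y` consists of the bits `⟨i, j⟩` with `i, j < n` of row `k` of `W`. Here `Y` and `W` have
index `1` and `2`, and the number variables `n`, `k` have index `0`, `1`. -/
def isRowFormula : Formula :=
  and (allLt 4 (len 1) (imp (mem (var 4) 1) (exLt 2 (var 0) (exLt 3 (var 0)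
      (and (eqN (var 4) (pair (var 2) (var 3)))
        (mem (pair (var 1) (pair (var 2) (var 3))) 2))))))
    (allLt 2 (var 0) (allLt 3 (var 0) (imp (mem (pair (var 1) (pair (var 2) (var 3))) 2)
      (mem (pair (var 2) (var 3)) 1))))

/-- The meaning in `M` of `isRowFormula`. -/
def Struct.IsRow (M : Struct) (n k : M.Num) (Y W : M.Str) : Prop :=
  (∀ a, M.lt a (M.len Y) → M.mem a Y → ∃ i, M.lt i n ∧ ∃ j, M.lt j n ∧
    a = M.pair i j ∧ M.mem (M.pair k (M.pair i j)) W) ∧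
  ∀ i, M.lt i n → ∀ j, M.lt j n → M.mem (M.pair k (M.pair i j)) W → M.mem (M.pair i j) Y

theorem realize_isRowFormula (M : Struct) (e : ℕ → M.Num) (E : ℕ → M.Str) :
    isRowFormula.Realize M e E ↔ M.IsRow (e 0) (e 1) (E 1) (E 2) := by
  simp [isRowFormula, Struct.IsRow]

theorem isSigmaB0_isRowFormula : isRowFormula.IsSigmaB0 :=
  .and (.allLt (by decide) (.imp (.mem _ _) (.exLt (by decide) (.exLt (by decide)
    (.and (.eqN _ _) (.mem _ _)))))) (.allLt (by decide) (.allLt (by decide)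
    (.imp (.mem _ _) (.mem _ _))))

theorem eq_of_isRow {M : Struct} (hM : M.Models V0) {n k : M.Num} {W Y Y' : M.Str}
    (h : M.IsRow n k Y W) (h' : M.IsRow n k Y' W) : Y = Y' := by
  refine hM.str_ext fun a => ⟨fun ha => ?_, fun ha => ?_⟩
  · obtain ⟨i, hi, j, hj, rfl, hW⟩ := h.1 a (hM.basic.lt_len _ _ ha) ha
    exact h'.2 i hi j hj hW
  · obtain ⟨i, hi, j, hj, rfl, hW⟩ := h'.1 a (hM.basic.lt_len _ _ ha) ha
    exact h.2 i hi j hj hW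

theorem exists_isRow {M : Struct} (hM : M.Models V0) (n k : M.Num) (W : M.Str) :
    ∃ Y, M.IsRow n k Y W := by
  have B := hM.basic
  obtain ⟨Y, hlen, hY⟩ := hM.comprehension
    (φ := exLt 2 (var 0) (exLt 3 (var 0) (and (eqN (var 4) (pair (var 2) (var 3)))
      (mem (pair (var 1) (pair (var 2) (var 3))) 2))))
    (.exLt (by decide) (.exLt (by decide) (.and (.eqN _ _) (.mem _ _)))) 4
    (fun v => if v = 0 then n else k) (fun _ => W) (M.len W)
  refine ⟨Y, fun a ha haY => ?_, fun i hi j hj hW => ?_⟩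
  · simpa using (hY a (hM.lt_of_lt_of_le ha hlen)).1 haY
  · refine (hY _ (hM.lt_of_le_of_lt (hM.le_pair_right k _) (B.lt_len _ _ hW))).2 ?_
    simpa using ⟨i, hi, j, hj, rfl, hW⟩

theorem standardModel_isRow (n k : ℕ) (X : Finset ℕ) :
    standardModel.IsRow n k (pow2 n k X) (powSeq2 n k X) := by
  refine ⟨fun a _ ha => ?_, fun (i : ℕ) hi (j : ℕ) hj hW => ?_⟩
  · obtain ⟨i, j, h, rfl⟩ := mem_pow2_iff.1 ha
    exact ⟨(i : ℕ), standardModel_lt_iff.2 i.2, (j : ℕ), standardModel_lt_iff.2 j.2, rfl,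
      (pair_mem_powSeq2_iff le_rfl i j).2 h⟩
  · have hi := standardModel_lt_iff.1 hi
    have hj := standardModel_lt_iff.1 hj
    exact mem_pow2_iff.2 ⟨⟨i, hi⟩, ⟨j, hj⟩, (pair_mem_powSeq2_iff le_rfl ⟨i, hi⟩ ⟨j, hj⟩).1 hW, rfl⟩

/-- The formula that defines `Pow₂`: `Y` is row `k` of the list `W` of the powers. -/
def pow2Formula : Formula :=
  exSLe 2 (pair (var 1) (pair (var 0) (var 0)))
    (exSLe 3 (pair (var 1) (pair (var 0) (pair (var 0) (var 0))))
      (and (alpha2At 2 3) isRowFormula))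

theorem realize_pow2Formula (M : Struct) (e : ℕ → M.Num) (E : ℕ → M.Str) (Y : M.Str) :
    pow2Formula.Realize M e (Function.update E 1 Y) ↔
      ∃ W, M.le (M.len W) (M.pair (e 1) (M.pair (e 0) (e 0))) ∧
      ∃ Z, M.le (M.len Z) (M.pair (e 1) (M.pair (e 0) (M.pair (e 0) (e 0)))) ∧
        M.Alpha2 (e 0) (e 1) (E 0) W Z ∧ M.IsRow (e 0) (e 1) Y W := by
  simp [pow2Formula, realize_alpha2At, realize_isRowFormula]

theorem strLen_powSeq2_le (n k : ℕ) (X : Finset ℕ) :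
    strLen (powSeq2 n k X) ≤ pairNat k (pairNat n n) := by
  refine strLen_le_iff.2 fun a ha => ?_
  obtain ⟨l, hl, i, j, -, rfl⟩ := mem_powSeq2_iff.1 ha
  exact pairNat_lt_pairNat_right hl (pairNat_lt_pairNat_left i.2 j.2.le)

theorem stringDefinable_pow2 : StringDefinable SigmaB1 VParityL 2 1
    (fun x X => pow2 (x 0) (x 1) (X 0)) := by
  refine stringDefinable_of_unique V0_subset_VParityL (φ := pow2Formula)
    (.exSLe (by decide) (.exSLe (by decide)
      (.sigmaB0 (.and (isSigmaB0_alpha2At 2 3) isSigmaB0_isRowFormula)))) (by decide +kernel) (by decide +kernel)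
    (fun M hM e E => ?_) (fun M hM e E A A' h h' => ?_) (fun e E => ?_)
  · obtain ⟨W, Z, hW, hZ, h⟩ := exists_alpha2 hM e E
    obtain ⟨Y, hY⟩ := exists_isRow (hM.mono V0_subset_VParityL) (e 0) (e 1) W
    exact ⟨Y, (realize_pow2Formula M e E Y).2 ⟨W, hW, Z, hZ, h, hY⟩⟩
  · obtain ⟨W, -, Z, -, h, hr⟩ := (realize_pow2Formula M e E A).1 h
    obtain ⟨W', -, Z', -, h', hr'⟩ := (realize_pow2Formula M e E A').1 h'
    obtain rfl := eq_of_alpha2 hM h h'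
    exact eq_of_isRow hM hr hr'
  · exact (realize_pow2Formula standardModel e E _).2
      ⟨powSeq2 (e 0) (e 1) (E 0), strLen_powSeq2_le (e 0) (e 1) (E 0),
        parityTable (e 0) (e 1) (E 0) (powSeq2 (e 0) (e 1) (E 0)),
        strLen_parityTable_le (e 0) (e 1) (E 0) (powSeq2 (e 0) (e 1) (E 0)),
        standardModel_alpha2 (e 0) (e 1) (E 0), standardModel_isRow (e 0) (e 1) (E 0)⟩

/-! ### Matrix powering over `ℤ`: uniqueness in models of `V⁰` -/

namespace Struct

/-- There is a position below `d` where `p` holds and above which, up to `d`, `q` holds. Carries,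
borrows and comparisons of binary numbers are of this form. -/
def Dominant (M : Struct) (p q : M.Num → Prop) (d : M.Num) : Prop :=
  ∃ a, M.lt a d ∧ p a ∧ ∀ g, M.lt g d → M.lt a g → q g

/-- There is a carry into bit `d` in the sum of `A` and `B`. -/
def Carry (M : Struct) (A B : M.Num → Prop) (d : M.Num) : Prop :=
  M.Dominant (fun a => A a ∧ B a) (fun g => A g ∨ B g) d

/-- Bit `d` of the sum of `A` and `B`. -/
def SumBit (M : Struct) (A B : M.Num → Prop) (d : M.Num) : Prop :=
  Xor (Xor (A d) (B d)) (M.Carry A B d)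

/-- The number `A` is smaller than the number `B`, where only bits below `D` count. -/
def Less (M : Struct) (A B : M.Num → Prop) (D : M.Num) : Prop :=
  M.Dominant (fun a => B a ∧ ¬ A a) (fun g => A g → B g) D

/-- Bit `d` of the absolute value of `A - B`, where only bits below `D` count. There is a borrow from
bit `d` in `A - B` iff the number formed by the bits of `A` below `d` is smaller than that of `B`. -/
def DiffBit (M : Struct) (A B : M.Num → Prop) (D d : M.Num) : Prop :=
  Xor (Xor (A d) (B d)) (M.Less B A D ∧ M.Less A B d ∨ M.Less A B D ∧ M.Less B A d)

/-- The width `D = k(n + |X|) + 1`. -/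
def width (M : Struct) (n k : M.Num) (X : M.Str) : M.Num :=
  M.add (M.mul k (M.add n (M.len X))) M.one

variable (M : Struct)

/-- The bit `X^{[i][j]}(d)`. -/
def entryBit (X : M.Str) (i j d : M.Num) : Prop := M.mem (M.pair i (M.pair j d)) X

/-- The bit `Y^{[l][i][j]}(d)`. -/
def listBit (Y : M.Str) (l i j d : M.Num) : Prop :=
  M.mem (M.pair l (M.pair i (M.pair j d))) Y

/-- The bits of the partial products `Q(b, c)` stored in `Z`. -/
def prodBit (Z : M.Str) (l i j b c d : M.Num) : Prop :=
  M.mem (M.pair M.zero (M.pair l (M.pair i (M.pair j (M.pair b (M.pair c d)))))) Z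

/-- The bits of the partial sums stored in `Z`: those of the nonnegative terms for `s = 1` and those
of the negative terms for `s = 2`. -/
def partialSumBit (Z : M.Str) (s l i j b d : M.Num) : Prop :=
  M.mem (M.pair s (M.pair l (M.pair i (M.pair j (M.pair b d))))) Z

/-- Bit `d` of the term that bit `c` of the absolute value of `X^{[i][b]}` contributes to its product
with that of `Y^{[l][b][j]}`. -/
def shiftedBit (X Y : M.Str) (l i j b c d : M.Num) : Prop :=
  M.entryBit X i b (M.add c M.one) ∧
    ∃ g, M.le g d ∧ M.add c g = d ∧ M.listBit Y l b j (M.add g M.one)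

/-- The integers `X^{[i][b]}` and `Y^{[l][b][j]}` have the same sign bit. -/
def SameSign (X Y : M.Str) (l i j b : M.Num) : Prop :=
  M.entryBit X i b M.zero ↔ M.listBit Y l b j M.zero

/-- The step of the recursion in `alphaZ`: entry `(i, j)` of matrix `l + 1` of the list `Y` is obtained
from `X` and matrix `l` by the computation stored in `Z`. -/
def StepZ (n D : M.Num) (X Y Z : M.Str) (l i j : M.Num) : Prop :=
  (∀ b, M.lt b n → ∀ d, M.lt d D → ¬ M.prodBit Z l i j b M.zero d) ∧
  (∀ b, M.lt b n → ∀ c, M.lt c (M.len X) → ∀ d, M.lt d D →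
    (M.prodBit Z l i j b (M.add c M.one) d ↔
      M.SumBit (M.prodBit Z l i j b c) (M.shiftedBit X Y l i j b c) d)) ∧
  (∀ d, M.lt d D → ¬ M.partialSumBit Z M.one l i j M.zero d ∧
    ¬ M.partialSumBit Z (M.add M.one M.one) l i j M.zero d) ∧
  (∀ b, M.lt b n → ∀ d, M.lt d D →
    (M.partialSumBit Z M.one l i j (M.add b M.one) d ↔ M.SumBit (M.partialSumBit Z M.one l i j b)
      (fun d => M.SameSign X Y l i j b ∧ M.prodBit Z l i j b (M.len X) d) d) ∧
    (M.partialSumBit Z (M.add M.one M.one) l i j (M.add b M.one) d ↔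
      M.SumBit (M.partialSumBit Z (M.add M.one M.one) l i j b)
        (fun d => ¬ M.SameSign X Y l i j b ∧ M.prodBit Z l i j b (M.len X) d) d)) ∧
  (M.listBit Y (M.add l M.one) i j M.zero ↔
    M.Less (M.partialSumBit Z M.one l i j n) (M.partialSumBit Z (M.add M.one M.one) l i j n) D) ∧
  ∀ d, M.lt d D → (M.listBit Y (M.add l M.one) i j (M.add d M.one) ↔
    M.DiffBit (M.partialSumBit Z M.one l i j n) (M.partialSumBit Z (M.add M.one M.one) l i j n) D d)

/-- The meaning in `M` of the formula `alphaZ`: the list `Y` codes the first `k + 1` powers of the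
`n × n` integer matrix `X`, as witnessed by the computations stored in `Z`. -/
def AlphaZ (n k : M.Num) (X Y Z : M.Str) : Prop :=
  (∀ b, M.lt b (M.len Y) → M.mem b Y → ∃ l, M.le l k ∧ ∃ i, M.lt i n ∧ ∃ j, M.lt j n ∧
    ∃ d, M.le d (M.width n k X) ∧ b = M.pair l (M.pair i (M.pair j d))) ∧
  (∀ i, M.lt i n → ∀ j, M.lt j n → ∀ d, M.le d (M.width n k X) →
    (M.listBit Y M.zero i j d ↔ i = j ∧ d = M.one)) ∧
  ∀ l, M.lt l k → ∀ i, M.lt i n → ∀ j, M.lt j n → M.StepZ n (M.width n k X) X Y Z l i j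

end Struct

@[simp] theorem eval_widthZ (M : Struct) (e : ℕ → M.Num) (E : ℕ → M.Str) :
    widthZ.eval M e E = M.width (e 0) (e 1) (E 0) := rfl

/-- Bit `d` of `A` is borrowed from in `A - B` iff `B < A` and the number formed by the bits of `A`
below `d` is smaller than that of `B`. -/
theorem realize_borrow (M : Struct) (e : ℕ → M.Num) (E : ℕ → M.Str) (A B : Term → Formula)
    (D d : Term) : (borrow A B D d).Realize M e E ↔
      (less B A D).Realize M e E ∧ (less A B d).Realize M e E := by
  simp only [borrow, less, realize_and, realize_exLt, realize_neg, realize_allLt, realize_imp,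
    realize_or, imp_iff_not_or, and_left_comm (a := Realize M (B (var 8)) _ _)]

theorem realize_alphaZ (M : Struct) (e : ℕ → M.Num) (E : ℕ → M.Str) :
    alphaZ.Realize M e E ↔ M.AlphaZ (e 0) (e 1) (E 0) (E 1) (E 2) := by
  simp [alphaZ, Struct.AlphaZ, Struct.StepZ, sumBit, carry, less, realize_borrow, diffBit,
    Struct.DiffBit, Struct.SumBit, Struct.Carry, Struct.Less, Struct.Dominant,
    Struct.partialSumBit, Struct.prodBit, Struct.listBit, Struct.entryBit, Struct.shiftedBit,
    Struct.SameSign, and_assoc]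

theorem isSigmaB0_alphaZ : alphaZ.IsSigmaB0 := by
  repeat' first
    | exact .eqN _ _
    | exact .mem _ _
    | exact .le _ _
    | refine .neg ?_
    | refine .and ?_ ?_
    | refine .or ?_ ?_
    | refine .allLe (by decide) ?_
    | refine .exLe (by decide) ?_

section Congruence

variable {M : Struct} {A A' B B' : M.Num → Prop} {d D : M.Num}

theorem dominant_congr {p p' q q' : M.Num → Prop} (hp : ∀ a, M.lt a d → (p a ↔ p' a))
    (hq : ∀ a, M.lt a d → (q a ↔ q' a)) : M.Dominant p q d ↔ M.Dominant p' q' d :=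
  exists_congr fun a => and_congr_right fun ha => and_congr (hp a ha)
    (forall_congr' fun g => forall_congr' fun hg => forall_congr' fun _ => hq g hg)

theorem less_congr (hA : ∀ a, M.lt a D → (A a ↔ A' a)) (hB : ∀ a, M.lt a D → (B a ↔ B' a)) :
    M.Less A B D ↔ M.Less A' B' D :=
  dominant_congr (fun a ha => and_congr (hB a ha) (not_congr (hA a ha)))
    fun a ha => imp_congr (hA a ha) (hB a ha)

theorem sumBit_congr (hM : M.Models V0) (hA : ∀ a, M.lt a D → (A a ↔ A' a))
    (hB : ∀ a, M.lt a D → (B a ↔ B' a)) (hd : M.lt d D) :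
    M.SumBit A B d ↔ M.SumBit A' B' d := by
  have hlt : ∀ a, M.lt a d → M.lt a D := fun a ha => hM.lt_of_lt_of_le ha hd.1
  have hc : M.Carry A B d ↔ M.Carry A' B' d :=
    dominant_congr (fun a ha => and_congr (hA a (hlt a ha)) (hB a (hlt a ha)))
      fun a ha => or_congr (hA a (hlt a ha)) (hB a (hlt a ha))
  rw [Struct.SumBit, Struct.SumBit, hA d hd, hB d hd, hc]

theorem diffBit_congr (hM : M.Models V0) (hA : ∀ a, M.lt a D → (A a ↔ A' a))
    (hB : ∀ a, M.lt a D → (B a ↔ B' a)) (hd : M.lt d D) :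
    M.DiffBit A B D d ↔ M.DiffBit A' B' D d := by
  have hlt : ∀ a, M.lt a d → M.lt a D := fun a ha => hM.lt_of_lt_of_le ha hd.1
  have hA' := fun a ha => hA a (hlt a ha)
  have hB' := fun a ha => hB a (hlt a ha)
  rw [Struct.DiffBit, Struct.DiffBit, hA d hd, hB d hd, less_congr hA hB, less_congr hB hA,
    less_congr hA' hB', less_congr hB' hA']

end Congruence

section Uniqueness

variable {M : Struct} {n D : M.Num} {X Y Y' Z Z' : M.Str} {l i j : M.Num}

/-- One step of the recursion is determined by matrix `l`: the partial products agree by induction on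
`c`, and then the partial sums agree by induction on `b`. -/
theorem listBit_succ_congr (hM : M.Models V0) (h : M.StepZ n D X Y Z l i j)
    (h' : M.StepZ n D X Y' Z' l i j)
    (ih : ∀ b, M.lt b n → ∀ d, M.le d D → (M.listBit Y l b j d ↔ M.listBit Y' l b j d)) :
    ∀ d, M.le d D →
      (M.listBit Y (M.add l M.one) i j d ↔ M.listBit Y' (M.add l M.one) i j d) := by
  have H := hM.basic
  obtain ⟨q₀, qs, p₀, ps, y₀, ys⟩ := h
  obtain ⟨q₀', qs', p₀', ps', y₀', ys'⟩ := h'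
  have hQ : ∀ b, M.lt b n → ∀ c, M.le c (M.len X) → ∀ d, M.lt d D →
      (M.prodBit Z l i j b c d ↔ M.prodBit Z' l i j b c d) := by
    intro b hb c hc
    refine hM.induction (φ := allLt 1 (var 2) (iff
        (mem (pair 0 (pair (var 3) (pair (var 4) (pair (var 5) (pair (var 6)
          (pair (var 0) (var 1))))))) 0)
        (mem (pair 0 (pair (var 3) (pair (var 4) (pair (var 5) (pair (var 6)
          (pair (var 0) (var 1))))))) 1)))
      (.allLt (by decide) (.iff (.mem _ _) (.mem _ _))) 0
      (fun v => if v = 2 then D else if v = 3 then l else if v = 4 then i else if v = 5 then j else b)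
      (fun v => if v = 0 then Z else Z')
      (P := fun c => ∀ d, M.lt d D → (M.prodBit Z l i j b c d ↔ M.prodBit Z' l i j b c d))
      (fun a => by simp [Struct.prodBit]) c
      (fun d hd => iff_of_false (q₀ b hb d hd) (q₀' b hb d hd)) fun c hcl ihc d hd => ?_
    have hcX := hM.lt_of_lt_of_le hcl hc
    rw [qs b hb c hcX d hd, qs' b hb c hcX d hd]
    refine sumBit_congr hM ihc (fun a ha => and_congr_right fun _ => exists_congr fun g =>
      and_congr_right fun hg => and_congr_right fun _ => ih b hb _ ?_) hd
    exact hM.succ_le_of_lt (hM.lt_of_le_of_lt hg ha)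
  have hsign : ∀ b, M.lt b n → (M.SameSign X Y l i j b ↔ M.SameSign X Y' l i j b) := fun b hb =>
    iff_congr Iff.rfl (ih b hb _ (H.zero_le D))
  have hsum : ∀ s, (∀ d, M.lt d D → (M.partialSumBit Z s l i j M.zero d ↔
        M.partialSumBit Z' s l i j M.zero d)) →
      (∀ b, M.lt b n → (∀ d, M.lt d D → (M.partialSumBit Z s l i j b d ↔
        M.partialSumBit Z' s l i j b d)) → ∀ d, M.lt d D →
          (M.partialSumBit Z s l i j (M.add b M.one) d ↔
            M.partialSumBit Z' s l i j (M.add b M.one) d)) →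
      ∀ d, M.lt d D → (M.partialSumBit Z s l i j n d ↔ M.partialSumBit Z' s l i j n d) := by
    intro s h₀ hs
    exact hM.induction (φ := allLt 1 (var 2) (iff
        (mem (pair (var 6) (pair (var 3) (pair (var 4) (pair (var 5) (pair (var 0) (var 1)))))) 0)
        (mem (pair (var 6) (pair (var 3) (pair (var 4) (pair (var 5) (pair (var 0) (var 1)))))) 1)))
      (.allLt (by decide) (.iff (.mem _ _) (.mem _ _))) 0
      (fun v => if v = 2 then D else if v = 3 then l else if v = 4 then i else if v = 5 then j else s)
      (fun v => if v = 0 then Z else Z')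
      (P := fun b => ∀ d, M.lt d D → (M.partialSumBit Z s l i j b d ↔
        M.partialSumBit Z' s l i j b d))
      (fun a => by simp [Struct.partialSumBit]) n h₀ hs
  have hP := hsum M.one (fun d hd => iff_of_false (p₀ d hd).1 (p₀' d hd).1)
    fun b hb ihb d hd => by
      rw [(ps b hb d hd).1, (ps' b hb d hd).1]
      exact sumBit_congr hM ihb
        (fun a ha => and_congr (hsign b hb) (hQ b hb _ (hM.le_refl _) a ha)) hd
  have hN := hsum (M.add M.one M.one) (fun d hd => iff_of_false (p₀ d hd).2 (p₀' d hd).2)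
    fun b hb ihb d hd => by
      rw [(ps b hb d hd).2, (ps' b hb d hd).2]
      exact sumBit_congr hM ihb
        (fun a ha => and_congr (not_congr (hsign b hb)) (hQ b hb _ (hM.le_refl _) a ha)) hd
  intro d hd
  by_cases hd₀ : d = M.zero
  · subst hd₀
    rw [y₀, y₀', less_congr hP hN]
  · obtain ⟨d, -, rfl⟩ := H.pred d hd₀
    have hd' := hM.lt_of_lt_of_le (hM.lt_succ_self d) hd
    rw [ys d hd', ys' d hd', diffBit_congr hM hP hN hd']

/-- In a model of `V⁰`, the list of integer matrices is determined: by induction on `l` the matrices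
with number `l` agree. -/
theorem eq_of_alphaZ (hM : M.Models V0) {k : M.Num} (h : M.AlphaZ n k X Y Z)
    (h' : M.AlphaZ n k X Y' Z') : Y = Y' := by
  have H := hM.basic
  obtain ⟨hf, h₀, hs⟩ := h
  obtain ⟨hf', h₀', hs'⟩ := h'
  generalize M.width n k X = D at *
  have key : ∀ l, M.le l k → ∀ i, M.lt i n → ∀ j, M.lt j n → ∀ d, M.le d D →
      (M.listBit Y l i j d ↔ M.listBit Y' l i j d) := by
    intro l hl
    refine hM.induction (φ := allLt 1 (var 4) (allLt 2 (var 4) (allLe 3 (var 5) (iff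
        (mem (pair (var 0) (pair (var 1) (pair (var 2) (var 3)))) 0)
        (mem (pair (var 0) (pair (var 1) (pair (var 2) (var 3)))) 1)))))
      (.allLt (by decide) (.allLt (by decide) (.allLe (by decide) (.iff (.mem _ _) (.mem _ _)))))
      0 (fun v => if v = 4 then n else D) (fun v => if v = 0 then Y else Y')
      (P := fun l => ∀ i, M.lt i n → ∀ j, M.lt j n → ∀ d, M.le d D →
        (M.listBit Y l i j d ↔ M.listBit Y' l i j d))
      (fun a => by simp [Struct.listBit]) l
      (fun i hi j hj d hd => (h₀ i hi j hj d hd).trans (h₀' i hi j hj d hd).symm)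
      fun l hlt ih i hi j hj => ?_
    have hlk := hM.lt_of_lt_of_le hlt hl
    exact listBit_succ_congr hM (hs l hlk i hi j hj) (hs' l hlk i hi j hj)
      fun b hb => ih b hb j hj
  refine hM.str_ext fun b => ⟨fun hb => ?_, fun hb => ?_⟩
  · obtain ⟨l, hl, i, hi, j, hj, d, hd, rfl⟩ := hf b (H.lt_len _ _ hb) hb
    exact (key l hl i hi j hj d hd).1 hb
  · obtain ⟨l, hl, i, hi, j, hj, d, hd, rfl⟩ := hf' b (H.lt_len _ _ hb) hb
    exact (key l hl i hi j hj d hd).2 hb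

end Uniqueness

/-! ### Binary arithmetic in the standard model -/

/-- The bit predicate of a natural number. -/
def natBits (a d : ℕ) : Prop := a.testBit d = true

theorem dominant_succ (p q : ℕ → Prop) (d : ℕ) : standardModel.Dominant p q (d + 1) ↔
    p d ∨ q d ∧ standardModel.Dominant p q d := by
  have key : ∀ d : ℕ, standardModel.Dominant p q d ↔
      ∃ a < d, p a ∧ ∀ g < d, a < g → q g := fun d =>
    exists_congr fun a => and_congr standardModel_lt_iff (and_congr_right fun _ =>
      forall_congr' fun g => imp_congr standardModel_lt_iff
        (imp_congr standardModel_lt_iff Iff.rfl))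
  refine (key (d + 1)).trans (Iff.trans ?_ (or_congr Iff.rfl (and_congr Iff.rfl (key d).symm)))
  constructor
  · rintro ⟨a, ha, hp, hq⟩
    rcases Nat.lt_succ_iff_lt_or_eq.1 ha with had | rfl
    · exact Or.inr ⟨hq d d.lt_succ_self had, a, had, hp, fun g hg => hq g (hg.trans d.lt_succ_self)⟩
    · exact Or.inl hp
  · rintro (hp | ⟨hq, a, had, hp, hq'⟩)
    · exact ⟨d, d.lt_succ_self, hp, fun g hg hdg => absurd hg (by omega)⟩
    · refine ⟨a, had.trans d.lt_succ_self, hp, fun g hg hag => ?_⟩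
      rcases Nat.lt_succ_iff_lt_or_eq.1 hg with hgd | rfl
      · exact hq' g hgd hag
      · exact hq

theorem not_dominant_zero (p q : ℕ → Prop) : ¬ standardModel.Dominant p q (0 : ℕ) :=
  fun ⟨_, ha, _⟩ => Nat.not_lt_zero _ (standardModel_lt_iff.1 ha)

theorem mod_two_pow_succ (a d : ℕ) :
    a % 2 ^ (d + 1) = a % 2 ^ d + 2 ^ d * (a.testBit d).toNat := by
  rw [Nat.mod_pow_succ, Nat.toNat_testBit]

theorem carry_natBits_iff (a b d : ℕ) : standardModel.Carry (natBits a) (natBits b) d ↔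
    2 ^ d ≤ a % 2 ^ d + b % 2 ^ d := by
  induction d with
  | zero => exact iff_of_false (not_dominant_zero _ _) (by simp [Nat.mod_one])
  | succ d ih =>
    refine (dominant_succ _ _ d).trans ?_
    have ih' : standardModel.Dominant (fun i : ℕ => natBits a i ∧ natBits b i)
        (fun i : ℕ => natBits a i ∨ natBits b i) d ↔ 2 ^ d ≤ a % 2 ^ d + b % 2 ^ d := ih
    have ha := Nat.mod_lt a (Nat.two_pow_pos d)
    have hb := Nat.mod_lt b (Nat.two_pow_pos d)
    refine (or_congr Iff.rfl (and_congr Iff.rfl ih')).trans ?_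
    rw [mod_two_pow_succ, mod_two_pow_succ, pow_succ, natBits, natBits]
    cases a.testBit d <;> cases b.testBit d <;> simp <;> omega

theorem less_natBits_iff (a b d : ℕ) : standardModel.Less (natBits a) (natBits b) d ↔
    a % 2 ^ d < b % 2 ^ d := by
  induction d with
  | zero => exact iff_of_false (not_dominant_zero _ _) (by simp [Nat.mod_one])
  | succ d ih =>
    refine (dominant_succ _ _ d).trans ?_
    have ih' : standardModel.Dominant (fun i : ℕ => natBits b i ∧ ¬ natBits a i)
        (fun i : ℕ => natBits a i → natBits b i) d ↔ a % 2 ^ d < b % 2 ^ d := ih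
    have ha := Nat.mod_lt a (Nat.two_pow_pos d)
    have hb := Nat.mod_lt b (Nat.two_pow_pos d)
    refine (or_congr Iff.rfl (and_congr Iff.rfl ih')).trans ?_
    rw [mod_two_pow_succ, mod_two_pow_succ, natBits, natBits]
    cases a.testBit d <;> cases b.testBit d <;> simp <;> omega

theorem natBits_add_iff (a b d : ℕ) : natBits (a + b) d ↔
    Xor (Xor (natBits a d) (natBits b d)) (2 ^ d ≤ a % 2 ^ d + b % 2 ^ d) := by
  simp only [natBits, Nat.testBit_eq_decide_div_mod_eq, Nat.add_div (Nat.two_pow_pos d),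
    decide_eq_true_eq, xor_def]
  split_ifs with h <;> simp only [h, not_true, not_false_iff, and_true, true_and, and_false,
    false_and, or_false, false_or] <;> omega

theorem sumBit_natBits_iff (a b d : ℕ) :
    standardModel.SumBit (natBits a) (natBits b) d ↔ natBits (a + b) d := by
  rw [natBits_add_iff, ← carry_natBits_iff]; rfl

/-- In `c = a + b` there is a carry into bit `d` iff the bits of `c` below `d` form a smaller number
than those of `b`. -/
theorem two_pow_le_mod_add_mod_iff (a b d : ℕ) :
    2 ^ d ≤ a % 2 ^ d + b % 2 ^ d ↔ (a + b) % 2 ^ d < b % 2 ^ d := by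
  have ha := Nat.mod_lt a (Nat.two_pow_pos d)
  have hb := Nat.mod_lt b (Nat.two_pow_pos d)
  rw [Nat.add_mod]
  generalize a % 2 ^ d = a at *
  generalize b % 2 ^ d = b at *
  by_cases h : 2 ^ d ≤ a + b
  · rw [Nat.mod_eq_sub_mod h, Nat.mod_eq_of_lt (by omega)]; omega
  · rw [Nat.mod_eq_of_lt (by omega)]; omega

theorem natBits_sub_iff {a b : ℕ} (h : b ≤ a) (d : ℕ) : natBits (a - b) d ↔
    Xor (Xor (natBits a d) (natBits b d)) (a % 2 ^ d < b % 2 ^ d) := by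
  obtain ⟨c, rfl⟩ := Nat.exists_eq_add_of_le' h
  rw [Nat.add_sub_cancel, natBits_add_iff, two_pow_le_mod_add_mod_iff]
  simp only [xor_def]; tauto

theorem diffBit_natBits_iff {a b D : ℕ} (ha : a < 2 ^ D) (hb : b < 2 ^ D) (d : ℕ) :
    standardModel.DiffBit (natBits a) (natBits b) D d ↔ natBits ((a : ℤ) - b).natAbs d := by
  have key : standardModel.DiffBit (natBits a) (natBits b) D d ↔
      Xor (Xor (natBits a d) (natBits b d))
        (b < a ∧ a % 2 ^ d < b % 2 ^ d ∨ a < b ∧ b % 2 ^ d < a % 2 ^ d) := by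
    refine iff_of_eq (congrArg (Xor _) (propext ?_))
    refine or_congr (and_congr ?_ (less_natBits_iff a b d)) (and_congr ?_ (less_natBits_iff b a d))
    · rw [less_natBits_iff, Nat.mod_eq_of_lt ha, Nat.mod_eq_of_lt hb]
    · rw [less_natBits_iff, Nat.mod_eq_of_lt ha, Nat.mod_eq_of_lt hb]
  rw [key]
  rcases le_total b a with h | h
  · rw [show ((a : ℤ) - b).natAbs = a - b by omega, natBits_sub_iff h]
    rcases h.eq_or_lt with rfl | h'
    · simp
    · simp only [h', h'.not_gt, true_and, false_and, or_false]
  · rw [show ((a : ℤ) - b).natAbs = b - a by omega, natBits_sub_iff h]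
    rcases h.eq_or_lt with rfl | h'
    · simp
    · simp only [h', h'.not_gt, true_and, false_and, false_or, xor_comm (natBits a d)]

/-! ### Integer matrices in the standard model -/

theorem le_pairNat_right (x y : ℕ) : y ≤ pairNat x y := by
  unfold pairNat; omega

theorem mem_row_iff {x i : ℕ} {Z : Finset ℕ} : i ∈ row x Z ↔ pairNat x i ∈ Z := by
  simp only [row, Finset.mem_filter, Finset.mem_range, and_iff_right_iff_imp]
  exact fun h => (le_pairNat_right x i).trans_lt (lt_strLen_of_mem h)

theorem strLen_row_le (x : ℕ) (Z : Finset ℕ) : strLen (row x Z) ≤ strLen Z :=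
  strLen_le_iff.2 fun i hi => (le_pairNat_right x i).trans_lt (lt_strLen_of_mem (mem_row_iff.1 hi))

/-- The number given by the lowest `c` bits of the absolute value of the integer coded by `S`. -/
def lowBits (S : Finset ℕ) (c : ℕ) : ℕ :=
  ∑ c' ∈ Finset.range c, if c' + 1 ∈ S then 2 ^ c' else 0

theorem lowBits_lt (S : Finset ℕ) (c : ℕ) : lowBits S c < 2 ^ c := by
  induction c with
  | zero => simp [lowBits]
  | succ c ih =>
    rw [lowBits, Finset.sum_range_succ, ← lowBits, pow_succ]
    split_ifs <;> omega

theorem lowBits_eq_of_strLen_le {S : Finset ℕ} {c : ℕ} (h : strLen S ≤ c) :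
    lowBits S c = lowBits S (strLen S) := by
  refine (Finset.sum_subset (Finset.range_subset_range.2 h) fun x _ hx => if_neg fun hS => hx ?_).symm
  exact Finset.mem_range.2 (x.lt_succ_self.trans (lt_strLen_of_mem hS))

theorem intValue_eq (S : Finset ℕ) {c : ℕ} (h : strLen S ≤ c) :
    intValue S = (if 0 ∈ S then -1 else 1) * (lowBits S c : ℤ) := by
  rw [lowBits_eq_of_strLen_le h, intValue, lowBits]; push_cast; rfl

theorem zero_mem_intString_iff {x : ℤ} : 0 ∈ intString x ↔ x < 0 := by
  by_cases h : x < 0 <;> simp [intString, h]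

theorem succ_mem_intString_iff {x : ℤ} {d : ℕ} : d + 1 ∈ intString x ↔ natBits x.natAbs d := by
  have key : natBits x.natAbs d → d < x.natAbs := fun h =>
    d.lt_two_pow_self.trans_le (Nat.ge_two_pow_of_testBit h)
  by_cases h : x < 0 <;>
    simpa [intString, h, natBits] using key

/-- Entry `(i, j)` of the `l`-th power of the matrix coded by `X`, and `0` outside of the matrix. -/
def powEntry (n : ℕ) (X : Finset ℕ) (l i j : ℕ) : ℤ :=
  if h : i < n ∧ j < n then (matrixZ n X ^ l) ⟨i, h.1⟩ ⟨j, h.2⟩ else 0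

theorem powEntry_fin {n : ℕ} (X : Finset ℕ) (l : ℕ) (i j : Fin n) :
    powEntry n X l i j = (matrixZ n X ^ l) i j := by
  simp [powEntry]

/-- The string coding entry `(i, j)` of the matrix coded by `X`. -/
def entryStr (X : Finset ℕ) (i j : ℕ) : Finset ℕ := row j (row i X)

theorem mem_entryStr_iff {X : Finset ℕ} {i j d : ℕ} :
    d ∈ entryStr X i j ↔ pairNat i (pairNat j d) ∈ X :=
  mem_row_iff.trans mem_row_iff

theorem strLen_entryStr_le (X : Finset ℕ) (i j : ℕ) : strLen (entryStr X i j) ≤ strLen X :=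
  (strLen_row_le _ _).trans (strLen_row_le _ _)

theorem matrixZ_apply_eq (n : ℕ) (X : Finset ℕ) (i j : Fin n) :
    matrixZ n X i j = (if 0 ∈ entryStr X i j then -1 else 1) *
      (lowBits (entryStr X i j) (strLen X) : ℤ) :=
  intValue_eq _ (strLen_entryStr_le X i j)

theorem mem_powSeqZ_iff {n k : ℕ} {X : Finset ℕ} {a : ℕ} :
    a ∈ powSeqZ n k X ↔ ∃ l ≤ k, ∃ i < n, ∃ j < n, ∃ d ∈ intString (powEntry n X l i j),
      a = pairNat l (pairNat i (pairNat j d)) := by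
  simp only [powSeqZ, powZ, Finset.mem_biUnion, Finset.mem_range, Finset.mem_image,
    Finset.mem_univ, true_and, Prod.exists, Nat.lt_succ_iff]
  constructor
  · rintro ⟨l, hl, _, ⟨i, j, d, hd, rfl⟩, rfl⟩
    exact ⟨l, hl, i, i.2, j, j.2, d, by rwa [powEntry_fin], rfl⟩
  · rintro ⟨l, hl, i, hi, j, hj, d, hd, rfl⟩
    exact ⟨l, hl, _, ⟨⟨i, hi⟩, ⟨j, hj⟩, d, by rwa [← powEntry_fin], rfl⟩, rfl⟩

theorem listBit_powSeqZ_iff {n k l i j d : ℕ} {X : Finset ℕ} (hl : l ≤ k) (hi : i < n)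
    (hj : j < n) : standardModel.listBit (powSeqZ n k X) l i j d ↔
      d ∈ intString (powEntry n X l i j) := by
  refine mem_powSeqZ_iff.trans ⟨?_, fun h => ⟨l, hl, i, hi, j, hj, d, h, rfl⟩⟩
  rintro ⟨l', -, i', -, j', -, d', h, heq⟩
  obtain ⟨rfl, heq₁⟩ := pairNat_injective heq
  obtain ⟨rfl, heq₂⟩ := pairNat_injective heq₁
  obtain ⟨rfl, rfl⟩ := pairNat_injective heq₂
  exact h

/-- The product of the lowest `c` bits of the absolute value of entry `(i, b)` of the matrix with the
absolute value of entry `(b, j)` of its `l`-th power. -/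
def partialProd (n : ℕ) (X : Finset ℕ) (l i j b c : ℕ) : ℕ :=
  lowBits (entryStr X i b) c * (powEntry n X l b j).natAbs

/-- Whether entry `(i, b)` of the matrix and entry `(b, j)` of its `l`-th power have the same sign
bit. -/
def EqSign (n : ℕ) (X : Finset ℕ) (l i j b : ℕ) : Prop :=
  0 ∈ entryStr X i b ↔ powEntry n X l b j < 0

open Classical in
/-- The sum over `b' < b` of the absolute values of those terms of entry `(i, j)` of power `l + 1` for
which `p` holds. -/
noncomputable def partialSum (n : ℕ) (X : Finset ℕ) (p : ℕ → Prop) (l i j b : ℕ) : ℕ :=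
  ∑ b' ∈ Finset.range b, if p b' then partialProd n X l i j b' (strLen X) else 0

/-- The sum over `b' < b` of the nonnegative terms of entry `(i, j)` of power `l + 1`. -/
noncomputable def posSum (n : ℕ) (X : Finset ℕ) (l i j b : ℕ) : ℕ :=
  partialSum n X (EqSign n X l i j) l i j b

/-- The sum over `b' < b` of the absolute values of the negative terms of entry `(i, j)` of power
`l + 1`. -/
noncomputable def negSum (n : ℕ) (X : Finset ℕ) (l i j b : ℕ) : ℕ :=
  partialSum n X (fun b' => ¬ EqSign n X l i j b') l i j b

theorem powEntry_succ {n : ℕ} (X : Finset ℕ) (l : ℕ) {i j : ℕ} (hi : i < n) (hj : j < n) :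
    powEntry n X (l + 1) i j = posSum n X l i j n - negSum n X l i j n := by
  have h := powEntry_fin X (l + 1) ⟨i, hi⟩ ⟨j, hj⟩
  rw [h, pow_succ', Matrix.mul_apply, posSum, negSum, partialSum, partialSum, Finset.sum_range,
    Finset.sum_range]
  push_cast
  rw [← Finset.sum_sub_distrib]
  refine Finset.sum_congr rfl fun b _ => ?_
  rw [matrixZ_apply_eq, ← powEntry_fin X l b ⟨j, hj⟩, partialProd, EqSign]
  push_cast
  rcases lt_or_ge (powEntry n X l b j) 0 with h | h
  · rw [abs_of_neg h]
    by_cases h₀ : 0 ∈ entryStr X i b <;> simp [h, h₀]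
  · rw [abs_of_nonneg h]
    by_cases h₀ : 0 ∈ entryStr X i b <;> simp [h.not_gt, h₀]

theorem posSum_add_negSum (n : ℕ) (X : Finset ℕ) (l i j b : ℕ) :
    posSum n X l i j b + negSum n X l i j b =
      ∑ b' ∈ Finset.range b, partialProd n X l i j b' (strLen X) := by
  rw [posSum, negSum, partialSum, partialSum, ← Finset.sum_add_distrib]
  refine Finset.sum_congr rfl fun b' _ => ?_
  by_cases h : EqSign n X l i j b' <;> simp [h]

/-- The bound `2^{l(n + |X|)}` on the entries of the `l`-th power, together with the same bound on the
sum of the absolute values of the terms of the next one. -/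
theorem natAbs_powEntry_le (n : ℕ) (X : Finset ℕ) (l : ℕ) :
    ∀ i < n, ∀ j < n, (powEntry n X l i j).natAbs ≤ 2 ^ (l * (n + strLen X)) ∧
      posSum n X l i j n + negSum n X l i j n ≤ 2 ^ ((l + 1) * (n + strLen X)) := by
  have step : ∀ l, (∀ i < n, ∀ j < n, (powEntry n X l i j).natAbs ≤ 2 ^ (l * (n + strLen X))) →
      ∀ i, ∀ j < n,
        posSum n X l i j n + negSum n X l i j n ≤ 2 ^ ((l + 1) * (n + strLen X)) := by
    intro l h i j hj
    rw [posSum_add_negSum]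
    calc ∑ b ∈ Finset.range n, partialProd n X l i j b (strLen X)
        ≤ ∑ b ∈ Finset.range n, 2 ^ strLen X * 2 ^ (l * (n + strLen X)) :=
          Finset.sum_le_sum fun b hb =>
            Nat.mul_le_mul (lowBits_lt _ _).le (h b (Finset.mem_range.1 hb) j hj)
      _ = n * (2 ^ strLen X * 2 ^ (l * (n + strLen X))) := by simp
      _ ≤ 2 ^ n * (2 ^ strLen X * 2 ^ (l * (n + strLen X))) :=
          Nat.mul_le_mul_right _ n.lt_two_pow_self.le
      _ = 2 ^ ((l + 1) * (n + strLen X)) := by rw [← pow_add, ← pow_add]; congr 1; ring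
  have bound : ∀ i < n, ∀ j < n, (powEntry n X l i j).natAbs ≤ 2 ^ (l * (n + strLen X)) := by
    induction l with
    | zero =>
      intro i hi j hj
      rw [powEntry_fin X 0 ⟨i, hi⟩ ⟨j, hj⟩, pow_zero, Matrix.one_apply]
      split_ifs <;> simp
    | succ l ih =>
      intro i hi j hj
      have := step l ih i j hj
      rw [powEntry_succ X l hi hj]
      omega
  exact fun i hi j hj => ⟨bound i hi j hj, step l bound i j hj⟩

theorem posSum_add_negSum_lt {n k l i j : ℕ} (X : Finset ℕ) (hl : l < k) (hi : i < n) (hj : j < n) :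
    posSum n X l i j n + negSum n X l i j n < 2 ^ (k * (n + strLen X) + 1) :=
  ((natAbs_powEntry_le n X l i hi j hj).2.trans
    (Nat.pow_le_pow_right two_pos (Nat.mul_le_mul_right _ hl))).trans_lt
      (Nat.pow_lt_pow_right one_lt_two (Nat.lt_succ_self _))

/-! ### The record of the computation over `ℤ` -/

/-- The width `D = k(n + |X|) + 1` in the standard model. -/
def widthNat (n k : ℕ) (X : Finset ℕ) : ℕ := k * (n + strLen X) + 1

/-- The number `a` is the position of a bit `1` in the record of the computation of the powers: bit `d`
of a partial product, of a sum of nonnegative terms or of a sum of negative terms. -/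
def IsComputationBit (n k : ℕ) (X : Finset ℕ) (a : ℕ) : Prop :=
  (∃ l i j b c d, (l < k ∧ i < n ∧ j < n ∧ b < n ∧ c ≤ strLen X ∧ d < widthNat n k X) ∧
    a = pairNat 0 (pairNat l (pairNat i (pairNat j (pairNat b (pairNat c d))))) ∧
    natBits (partialProd n X l i j b c) d) ∨
  (∃ l i j b d, (l < k ∧ i < n ∧ j < n ∧ b ≤ n ∧ d < widthNat n k X) ∧
    a = pairNat 1 (pairNat l (pairNat i (pairNat j (pairNat b d)))) ∧
    natBits (posSum n X l i j b) d) ∨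
  ∃ l i j b d, (l < k ∧ i < n ∧ j < n ∧ b ≤ n ∧ d < widthNat n k X) ∧
    a = pairNat 2 (pairNat l (pairNat i (pairNat j (pairNat b d)))) ∧
    natBits (negSum n X l i j b) d

/-- The bound on the length of the record of the computation. -/
def computationBound (n k : ℕ) (X : Finset ℕ) : ℕ :=
  pairNat 2 (pairNat k (pairNat n (pairNat n (pairNat n (pairNat (strLen X) (widthNat n k X))))))

open Classical in
/-- The record of the computation of the powers of the integer matrix coded by `X`. -/
noncomputable def computationTable (n k : ℕ) (X : Finset ℕ) : Finset ℕ :=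
  (Finset.range (computationBound n k X)).filter (IsComputationBit n k X)

open Classical in
theorem strLen_computationTable_le (n k : ℕ) (X : Finset ℕ) :
    strLen (computationTable n k X) ≤ computationBound n k X :=
  strLen_le_iff.2 fun _ hx => Finset.mem_range.1 (Finset.mem_filter.1 hx).1

open Classical in
theorem mem_computationTable_iff {n k : ℕ} {X : Finset ℕ} {a : ℕ} :
    a ∈ computationTable n k X ↔ IsComputationBit n k X a := by
  rw [computationTable, Finset.mem_filter, and_iff_right_iff_imp, Finset.mem_range]
  have tail : ∀ {b d : ℕ}, b ≤ n → d < widthNat n k X →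
      pairNat b d ≤ pairNat n (pairNat (strLen X) (widthNat n k X)) := fun hb hd =>
    pairNat_le_pairNat hb (hd.le.trans (le_pairNat_right _ _))
  rintro (⟨l, i, j, b, c, d, ⟨hl, hi, hj, hb, hc, hd⟩, rfl, -⟩ |
    ⟨l, i, j, b, d, ⟨hl, hi, hj, hb, hd⟩, rfl, -⟩ | ⟨l, i, j, b, d, ⟨hl, hi, hj, hb, hd⟩, rfl, -⟩)
  · exact pairNat_lt_pairNat_right (Nat.zero_le _) (pairNat_lt_pairNat_left hl
      (pairNat_le_pairNat hi.le (pairNat_le_pairNat hj.le (pairNat_le_pairNat hb.le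
        (pairNat_le_pairNat hc hd.le)))))
  · exact pairNat_lt_pairNat_right (by decide) (pairNat_lt_pairNat_left hl
      (pairNat_le_pairNat hi.le (pairNat_le_pairNat hj.le (tail hb hd))))
  · exact pairNat_lt_pairNat_right le_rfl (pairNat_lt_pairNat_left hl
      (pairNat_le_pairNat hi.le (pairNat_le_pairNat hj.le (tail hb hd))))

section Table

variable {n k l i j b c d : ℕ} {X : Finset ℕ}

theorem prodBit_computationTable_iff (hl : l < k) (hi : i < n) (hj : j < n) (hb : b < n)
    (hc : c ≤ strLen X) (hd : d < widthNat n k X) :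
    standardModel.prodBit (computationTable n k X) l i j b c d ↔
      natBits (partialProd n X l i j b c) d := by
  refine mem_computationTable_iff.trans ⟨?_, fun h =>
    Or.inl ⟨l, i, j, b, c, d, ⟨hl, hi, hj, hb, hc, hd⟩, rfl, h⟩⟩
  rintro (⟨l', i', j', b', c', d', -, heq, h⟩ | ⟨l', i', j', b', d', -, heq, h⟩ |
    ⟨l', i', j', b', d', -, heq, h⟩)
  · obtain ⟨-, heq₀⟩ := pairNat_injective heq
    obtain ⟨rfl, heq₁⟩ := pairNat_injective heq₀
    obtain ⟨rfl, heq₂⟩ := pairNat_injective heq₁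
    obtain ⟨rfl, heq₃⟩ := pairNat_injective heq₂
    obtain ⟨rfl, heq₄⟩ := pairNat_injective heq₃
    obtain ⟨rfl, rfl⟩ := pairNat_injective heq₄
    exact h
  · exact absurd (pairNat_injective heq).1 zero_ne_one
  · exact absurd (pairNat_injective heq).1 (show (0 : ℕ) ≠ 2 by decide)

theorem partialSumBit_one_computationTable_iff (hl : l < k) (hi : i < n) (hj : j < n) (hb : b ≤ n)
    (hd : d < widthNat n k X) :
    standardModel.partialSumBit (computationTable n k X) (1 : ℕ) l i j b d ↔
      natBits (posSum n X l i j b) d := by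
  refine mem_computationTable_iff.trans ⟨?_, fun h =>
    Or.inr (Or.inl ⟨l, i, j, b, d, ⟨hl, hi, hj, hb, hd⟩, rfl, h⟩)⟩
  rintro (⟨l', i', j', b', c', d', -, heq, h⟩ | ⟨l', i', j', b', d', -, heq, h⟩ |
    ⟨l', i', j', b', d', -, heq, h⟩)
  · exact absurd (pairNat_injective heq).1 (by decide)
  · obtain ⟨-, heq₀⟩ := pairNat_injective heq
    obtain ⟨rfl, heq₁⟩ := pairNat_injective heq₀
    obtain ⟨rfl, heq₂⟩ := pairNat_injective heq₁
    obtain ⟨rfl, heq₃⟩ := pairNat_injective heq₂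
    obtain ⟨rfl, rfl⟩ := pairNat_injective heq₃
    exact h
  · exact absurd (pairNat_injective heq).1 (by decide)

theorem partialSumBit_two_computationTable_iff (hl : l < k) (hi : i < n) (hj : j < n) (hb : b ≤ n)
    (hd : d < widthNat n k X) :
    standardModel.partialSumBit (computationTable n k X) (2 : ℕ) l i j b d ↔
      natBits (negSum n X l i j b) d := by
  refine mem_computationTable_iff.trans ⟨?_, fun h =>
    Or.inr (Or.inr ⟨l, i, j, b, d, ⟨hl, hi, hj, hb, hd⟩, rfl, h⟩)⟩
  rintro (⟨l', i', j', b', c', d', -, heq, h⟩ | ⟨l', i', j', b', d', -, heq, h⟩ |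
    ⟨l', i', j', b', d', -, heq, h⟩)
  · exact absurd (pairNat_injective heq).1 (by decide)
  · exact absurd (pairNat_injective heq).1 (by decide)
  · obtain ⟨-, heq₀⟩ := pairNat_injective heq
    obtain ⟨rfl, heq₁⟩ := pairNat_injective heq₀
    obtain ⟨rfl, heq₂⟩ := pairNat_injective heq₁
    obtain ⟨rfl, heq₃⟩ := pairNat_injective heq₂
    obtain ⟨rfl, rfl⟩ := pairNat_injective heq₃
    exact h

theorem shiftedBit_powSeqZ_iff (hl : l ≤ k) (hb : b < n) (hj : j < n) :
    standardModel.shiftedBit X (powSeqZ n k X) l i j b c d ↔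
      natBits ((if c + 1 ∈ entryStr X i b then 2 ^ c else 0) * (powEntry n X l b j).natAbs) d := by
  have h₁ : standardModel.shiftedBit X (powSeqZ n k X) l i j b c d ↔ c + 1 ∈ entryStr X i b ∧
      ∃ g ≤ d, c + g = d ∧ natBits (powEntry n X l b j).natAbs g :=
    and_congr mem_entryStr_iff.symm (exists_congr fun g => and_congr_right fun _ =>
      and_congr_right fun _ => (listBit_powSeqZ_iff hl hb hj).trans succ_mem_intString_iff)
  rw [h₁]
  by_cases h : c + 1 ∈ entryStr X i b
  · simp only [h, true_and, if_true, natBits, Nat.testBit_two_pow_mul, Bool.and_eq_true,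
      decide_eq_true_eq]
    constructor
    · rintro ⟨g, -, rfl, hg⟩
      exact ⟨Nat.le_add_right c g, by rwa [Nat.add_sub_cancel_left]⟩
    · rintro ⟨hcd, hg⟩
      exact ⟨d - c, Nat.sub_le d c, Nat.add_sub_cancel' hcd, hg⟩
  · simp [h, natBits]

theorem sameSign_powSeqZ_iff (hl : l ≤ k) (hb : b < n) (hj : j < n) :
    standardModel.SameSign X (powSeqZ n k X) l i j b ↔ EqSign n X l i j b :=
  iff_congr mem_entryStr_iff.symm
    ((listBit_powSeqZ_iff hl hb hj).trans zero_mem_intString_iff)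

theorem partialProd_succ : partialProd n X l i j b (c + 1) = partialProd n X l i j b c +
    (if c + 1 ∈ entryStr X i b then 2 ^ c else 0) * (powEntry n X l b j).natAbs := by
  rw [partialProd, lowBits, Finset.sum_range_succ, ← lowBits, Nat.add_mul, ← partialProd]

open Classical in
theorem partialSum_succ (p : ℕ → Prop) : partialSum n X p l i j (b + 1) = partialSum n X p l i j b +
    if p b then partialProd n X l i j b (strLen X) else 0 :=
  Finset.sum_range_succ _ _

open Classical in
theorem natBits_ite_iff {p : Prop} {a : ℕ} : natBits (if p then a else 0) d ↔ p ∧ natBits a d := by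
  by_cases h : p <;> simp [h, natBits]

/-- In the standard model, the record of the computation witnesses the step from power `l` to power
`l + 1`. The bits are right because all numbers involved at the end are below `2^D`; the intermediate
sums need not be bounded, since truncation commutes with addition. -/
theorem standardModel_stepZ (X : Finset ℕ) (hl : l < k) (hi : i < n) (hj : j < n) :
    standardModel.StepZ n (widthNat n k X) X (powSeqZ n k X) (computationTable n k X) l i j := by
  have hM := standardModel_models_V0
  have hQ : ∀ b < n, ∀ c ≤ strLen X, ∀ d : ℕ, standardModel.lt d (widthNat n k X) →
      (standardModel.prodBit (computationTable n k X) l i j b c d ↔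
        natBits (partialProd n X l i j b c) d) := fun b hb c hc d hd =>
    prodBit_computationTable_iff hl hi hj hb hc (standardModel_lt_iff.1 hd)
  have hP : ∀ b ≤ n, ∀ d : ℕ, standardModel.lt d (widthNat n k X) →
      (standardModel.partialSumBit (computationTable n k X) (1 : ℕ) l i j b d ↔
        natBits (posSum n X l i j b) d) := fun b hb d hd =>
    partialSumBit_one_computationTable_iff hl hi hj hb (standardModel_lt_iff.1 hd)
  have hN : ∀ b ≤ n, ∀ d : ℕ, standardModel.lt d (widthNat n k X) →
      (standardModel.partialSumBit (computationTable n k X) (2 : ℕ) l i j b d ↔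
        natBits (negSum n X l i j b) d) := fun b hb d hd =>
    partialSumBit_two_computationTable_iff hl hi hj hb (standardModel_lt_iff.1 hd)
  have hlt := posSum_add_negSum_lt X hl hi hj
  have hPlt : posSum n X l i j n < 2 ^ widthNat n k X := (Nat.le_add_right _ _).trans_lt hlt
  have hNlt : negSum n X l i j n < 2 ^ widthNat n k X := (Nat.le_add_left _ _).trans_lt hlt
  have hsucc := powEntry_succ X l hi hj
  refine ⟨fun (b : ℕ) hb (d : ℕ) hd => ?_, fun (b : ℕ) hb (c : ℕ) hc (d : ℕ) hd => ?_,
    fun (d : ℕ) hd => ⟨?_, ?_⟩, fun (b : ℕ) hb (d : ℕ) hd => ⟨?_, ?_⟩, ?_, fun (d : ℕ) hd => ?_⟩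
  · refine mt (hQ b (standardModel_lt_iff.1 hb) 0 (Nat.zero_le _) d hd).1 ?_
    simp [partialProd, lowBits, natBits]
  · have hb := standardModel_lt_iff.1 hb
    have hc : c < strLen X := standardModel_lt_iff.1 hc
    refine (hQ b hb (c + 1) hc d hd).trans (Iff.trans ?_
      (sumBit_congr hM (hQ b hb c hc.le) (fun d _ => shiftedBit_powSeqZ_iff hl.le hb hj) hd).symm)
    rw [partialProd_succ]
    exact (sumBit_natBits_iff _ _ d).symm
  · refine mt (hP 0 (Nat.zero_le _) d hd).1 ?_
    simp [posSum, partialSum, natBits]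
  · refine mt (hN 0 (Nat.zero_le _) d hd).1 ?_
    simp [negSum, partialSum, natBits]
  · have hb := standardModel_lt_iff.1 hb
    refine (hP (b + 1) hb d hd).trans (Iff.trans ?_ (sumBit_congr hM (hP b hb.le)
      (fun d hd => (and_congr (sameSign_powSeqZ_iff hl.le hb hj) (hQ b hb _ le_rfl d hd)).trans
        natBits_ite_iff.symm) hd).symm)
    rw [posSum, partialSum_succ]
    exact (sumBit_natBits_iff _ _ d).symm
  · have hb := standardModel_lt_iff.1 hb
    refine (hN (b + 1) hb d hd).trans (Iff.trans ?_ (sumBit_congr hM (hN b hb.le)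
      (fun d hd => (and_congr (not_congr (sameSign_powSeqZ_iff hl.le hb hj))
        (hQ b hb _ le_rfl d hd)).trans natBits_ite_iff.symm) hd).symm)
    rw [negSum, partialSum_succ]
    exact (sumBit_natBits_iff _ _ d).symm
  · refine (listBit_powSeqZ_iff hl hi hj).trans (zero_mem_intString_iff.trans (Iff.trans ?_
      (less_congr (hP n le_rfl) (hN n le_rfl)).symm))
    refine Iff.trans ?_ (less_natBits_iff _ _ _).symm
    rw [Nat.mod_eq_of_lt hPlt, Nat.mod_eq_of_lt hNlt, hsucc]
    omega
  · refine (listBit_powSeqZ_iff hl hi hj).trans (succ_mem_intString_iff.trans (Iff.trans ?_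
      (diffBit_congr hM (hP n le_rfl) (hN n le_rfl) hd).symm))
    rw [hsucc]
    exact (diffBit_natBits_iff hPlt hNlt d).symm

end Table

theorem standardModel_alphaZ (n k : ℕ) (X : Finset ℕ) :
    standardModel.AlphaZ n k X (powSeqZ n k X) (computationTable n k X) := by
  refine ⟨fun a _ ha => ?_, fun (i : ℕ) hi (j : ℕ) hj (d : ℕ) _ => ?_,
    fun (l : ℕ) hl (i : ℕ) hi (j : ℕ) hj => standardModel_stepZ X (standardModel_lt_iff.1 hl)
      (standardModel_lt_iff.1 hi) (standardModel_lt_iff.1 hj)⟩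
  · obtain ⟨l, hl, i, hi, j, hj, d, hd, rfl⟩ := mem_powSeqZ_iff.1 ha
    have hdD : d ≤ widthNat n k X := by
      obtain _ | d := d
      · exact Nat.zero_le _
      · have h₁ := Nat.ge_two_pow_of_testBit (succ_mem_intString_iff.1 hd)
        have h₂ := (natAbs_powEntry_le n X l i hi j hj).1
        have h₃ := (Nat.pow_le_pow_iff_right one_lt_two).1 (h₁.trans h₂)
        exact Nat.succ_le_succ (h₃.trans (Nat.mul_le_mul_right _ hl))
    exact ⟨l, hl, i, standardModel_lt_iff.2 hi, j, standardModel_lt_iff.2 hj, d, hdD, rfl⟩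
  · have hi := standardModel_lt_iff.1 hi
    have hj := standardModel_lt_iff.1 hj
    refine (listBit_powSeqZ_iff (Nat.zero_le k) hi hj).trans
      (Iff.trans ?_ (Iff.rfl : i = j ∧ d = 1 ↔ _))
    rw [powEntry_fin X 0 ⟨i, hi⟩ ⟨j, hj⟩, pow_zero, Matrix.one_apply]
    by_cases h : i = j
    · subst h; simpa [intString] using eq_comm
    · simp [h, intString]

/-! ### Definability in `V#L` -/

/-- The bound `⟨2, ⟨k, ⟨n, ⟨n, ⟨n, ⟨|X|, D⟩⟩⟩⟩⟩⟩` on the record of the computation. -/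
def computationTerm : Term :=
  pair (1 + 1) (pair (var 1) (pair (var 0) (pair (var 0) (pair (var 0) (pair (len 0) widthZ)))))

/-- The formula `∃ Z ≤ t, α(n, k, X, Y, Z)` that defines `PowSeq_ℤ`. -/
def powSeqZFormula : Formula := exSLe 2 computationTerm alphaZ

/-- The value of `computationTerm`. -/
def Struct.computationLen (M : Struct) (n k : M.Num) (X : M.Str) : M.Num :=
  M.pair (M.add M.one M.one) (M.pair k (M.pair n (M.pair n (M.pair n
    (M.pair (M.len X) (M.width n k X))))))

theorem standardModel_computationLen (n k : ℕ) (X : Finset ℕ) :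
    standardModel.computationLen n k X = computationBound n k X := rfl

theorem standardModel_len_le {S : Finset ℕ} {c : ℕ} (h : strLen S ≤ c) :
    standardModel.le (standardModel.len S) c := h

theorem strLen_computationTable_le_of_eq {n k : ℕ} {X : Finset ℕ} (c : ℕ)
    (hc : standardModel.computationLen n k X = c) : strLen (computationTable n k X) ≤ c := by
  subst hc
  exact (strLen_computationTable_le n k X).trans_eq (standardModel_computationLen n k X).symm

-- Unfolding this nested polynomial in `ℕ` to decide definitional equalities is infeasible.
attribute [local irreducible] Struct.computationLen

theorem standardModel_len_computationTable_le (n k : ℕ) (X : Finset ℕ) :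
    standardModel.le (standardModel.len (computationTable n k X))
      (standardModel.computationLen n k X) :=
  standardModel_len_le (strLen_computationTable_le_of_eq (standardModel.computationLen n k X) rfl)

theorem realize_powSeqZFormula (M : Struct) (e : ℕ → M.Num) (E : ℕ → M.Str) (Y : M.Str) :
    powSeqZFormula.Realize M e (Function.update E 1 Y) ↔
      ∃ Z, M.le (M.len Z) (M.computationLen (e 0) (e 1) (E 0)) ∧
        M.AlphaZ (e 0) (e 1) (E 0) Y Z := by
  simp [powSeqZFormula, computationTerm, Struct.computationLen, realize_alphaZ]

theorem exists_alphaZ {M : Struct} (hM : M.Models VSharpL) (e : ℕ → M.Num) (E : ℕ → M.Str) :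
    ∃ Y Z, M.le (M.len Z) (M.computationLen (e 0) (e 1) (E 0)) ∧
      M.AlphaZ (e 0) (e 1) (E 0) Y Z := by
  have h := hM PSZ (Or.inr rfl) e E
  simp only [PSZ, realize_exSLe, realize_alphaZ] at h
  obtain ⟨Y, -, Z, h⟩ := h
  exact ⟨Y, Z, by simpa [Struct.computationLen] using h⟩

theorem isSigmaB1_powSeqZFormula : powSeqZFormula.IsSigmaB1 :=
  .exSLe (by decide) (.sigmaB0 isSigmaB0_alphaZ)

theorem freeNum_powSeqZFormula : powSeqZFormula.freeNum ⊆ Finset.range 2 := by decide +kernel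

theorem freeStr_powSeqZFormula : powSeqZFormula.freeStr ⊆ Finset.range 2 := by decide +kernel

theorem stringDefinable_powSeqZ : StringDefinable SigmaB1 VSharpL 2 1
    (fun x X => powSeqZ (x 0) (x 1) (X 0)) := by
  have hT : V0 ⊆ VSharpL := Set.subset_union_left.trans Set.subset_union_left
  refine stringDefinable_of_unique hT isSigmaB1_powSeqZFormula freeNum_powSeqZFormula
    freeStr_powSeqZFormula
    (fun M hM e E => ?_) (fun M hM e E A A' h h' => ?_) (fun e E => ?_)
  · obtain ⟨Y, h⟩ := exists_alphaZ hM e E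
    exact ⟨Y, (realize_powSeqZFormula M e E Y).2 h⟩
  · obtain ⟨Z, -, h⟩ := (realize_powSeqZFormula M e E A).1 h
    obtain ⟨Z', -, h'⟩ := (realize_powSeqZFormula M e E A').1 h'
    exact eq_of_alphaZ hM h h'
  · exact (realize_powSeqZFormula standardModel e E _).2
      ⟨computationTable (e 0) (e 1) (E 0), standardModel_len_computationTable_le (e 0) (e 1) (E 0),
        standardModel_alphaZ (e 0) (e 1) (E 0)⟩

end TwoSorted

theorem mainTheorem10 :
    TwoSorted.StringDefinable TwoSorted.SigmaB1 TwoSorted.VParityL 2 1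
        (fun x X => TwoSorted.powSeq2 (x 0) (x 1) (X 0)) ∧
      TwoSorted.StringDefinable TwoSorted.SigmaB1 TwoSorted.VParityL 2 1
        (fun x X => TwoSorted.pow2 (x 0) (x 1) (X 0)) ∧
      TwoSorted.StringDefinable TwoSorted.SigmaB1 TwoSorted.VSharpL 2 1
        (fun x X => TwoSorted.powSeqZ (x 0) (x 1) (X 0)) :=
  ⟨TwoSorted.stringDefinable_powSeq2, TwoSorted.stringDefinable_pow2,
    TwoSorted.stringDefinable_powSeqZ⟩
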